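/- Let $\tau\in\mathbf C$ with $\mathrm{Im}\,\tau>0$, let $q=e^{-2i\pi\tau}$ (so $|q|>1$), and put $\sigma_qf(z)=f(qz)$. On $\mathbf C^*$ let $$\Theta_q(z)=\sum_{n\in\mathbf Z}(-1)^nq^{-\frac{n^2-n}2}z^n,\quad \Theta_{q,c}(z)=\Theta_q(c^{-1}z),\quad e_{q,c}=\frac{\Theta_q}{\Theta_{q,c}}\ (c\in\mathbf C^*),\quad l_q(z)=\frac{z\,\Theta_q'(z)}{\Theta_q(z)}.$$ Let $\mathbf k_0=\mathcal M(\mathbf C)$ be the field of meromorphic functions on $\mathbf C$ and $\mathbf k_0'=\mathbf C(\{z\})$ the field of germs of meromorphic functions at $0$ (convergent Laurent series with finite principal part). Inside the field of germs at $0$ of functions meromorphic in a punctured neighbourhood of $0$ (with poles allowed to accumulate at $0$), let $$\mathbf K_0=\mathbf k_0\big(l_q,(e_{q,c})_{c\in\mathbf C^*}\big),\qquad \mathbf K_0'=\mathbf k_0'\big(l_q,(e_{q,c})_{c\in\mathbf C^*}\big),\qquad \mathbf L_0'=\mathbf k_0'\big(\Theta_q',(\Theta_{q,c})_{c\in\mathbf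 C^*}\big).$$ Let $\mathbf E=\mathbf C/(\mathbf Z+\mathbf Z\tau)$, which $x\mapsto z=e^{2i\pi x}$ identifies with $\mathbf C^*/q^{\mathbf Z}$, and let $\mathcal M(\mathbf E)$ be the field of elliptic functions (meromorphic functions of $x\in\mathbf C$ with periods $1$ and $\tau$), regarded as functions of $z=e^{2i\pi x}\in\mathbf C^*$ and so as germs at $0$. Write $F^{\sigma_q}$ for the set of $\sigma_q$-invariant elements of $F$. Then $$\mathbf K_0^{\sigma_q}=\mathbf K_0'^{\,\sigma_q}=\mathbf L_0'^{\,\sigma_q}=\mathcal M(\mathbf C^*)^{\sigma_q}=\mathcal M(\mathbf E).$$ Moreover a nonzero germ belongs to $\mathcal M(\mathbf E)$ if and only if it is of the form $$\lambda\,\frac{\prod_{i=1}^r\Theta_{q,a_i}(z)}{\prod_{i=1}^r\Theta_{q,b_i}(z)}$$ with $r\ge 0$, $\lambda,a_i,b_i\in\mathbf C^*$ and $\prod_i a_i=\prod_i b_i$. -/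

import Mathlib

open Filter Topology

namespace QDiff

/-- The filter of sets which, in some punctured disc `0 < |z| < r`, contain a punctured
neighbourhood of every point, i.e. whose complement in that punctured disc is closed and discrete.
Two functions meromorphic in a punctured neighbourhood of `0` (possibly with poles accumulating
at `0`) are the same meromorphic function near `0` exactly when they agree along this filter. -/
noncomputable def nearZero : Filter ℂ := (𝓝[≠] (0 : ℂ)).bind fun z => 𝓝[≠] z

theorem isPreconnected_puncturedDisc {r : ℝ} (hr : 0 < r) :
    IsPreconnected {z : ℂ | z ≠ 0 ∧ ‖z‖ < r} := by
  have h : {z : ℂ | z ≠ 0 ∧ ‖z‖ < r} = Complex.exp '' {w : ℂ | w.re < Real.log r} := by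
    ext z
    constructor
    · rintro ⟨h0, h1⟩
      refine ⟨Complex.log z, ?_, Complex.exp_log h0⟩
      simp only [Set.mem_ofPred_eq, Complex.log_re]
      exact Real.log_lt_log (norm_pos_iff.2 h0) h1
    · rintro ⟨w, hw, rfl⟩
      refine ⟨Complex.exp_ne_zero _, ?_⟩
      rw [Complex.norm_exp]
      exact (Real.lt_log_iff_exp_lt hr).1 hw
  rw [h]
  exact (convex_halfSpace_re_lt _).isPreconnected.image _ Complex.continuous_exp.continuousOn

instance nearZero_neBot : NeBot nearZero := by
  refine ⟨fun h => ?_⟩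
  have h1 : ∀ᶠ _ in nearZero, False := by rw [h]; exact eventually_bot
  obtain ⟨z, hz⟩ := (eventually_bind.1 h1).exists
  exact hz.exists.elim fun _ => id

/-- A function meromorphic in a punctured neighbourhood of `0` is either zero near `0` or
nonzero near `0` (off a closed discrete set). -/
theorem eventually_zero_or_ne_zero {f : ℂ → ℂ} (hf : ∀ᶠ z in 𝓝[≠] (0 : ℂ), MeromorphicAt f z) :
    (∀ᶠ z in nearZero, f z = 0) ∨ (∀ᶠ z in nearZero, f z ≠ 0) := by
  rw [eventually_nhdsWithin_iff, Metric.eventually_nhds_iff] at hf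
  obtain ⟨r, hr, hf⟩ := hf
  have hU : MeromorphicOn f {z : ℂ | z ≠ 0 ∧ ‖z‖ < r} := fun z hz =>
    hf (by simpa using hz.2) hz.1
  have hmem : ∀ᶠ z in 𝓝[≠] (0 : ℂ), z ∈ {z : ℂ | z ≠ 0 ∧ ‖z‖ < r} := by
    rw [eventually_nhdsWithin_iff, Metric.eventually_nhds_iff]
    exact ⟨r, hr, fun y hy hy0 => ⟨hy0, by simpa using hy⟩⟩
  by_cases h : ∃ x ∈ {z : ℂ | z ≠ 0 ∧ ‖z‖ < r}, meromorphicOrderAt f x ≠ ⊤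
  · obtain ⟨x, hx, hxt⟩ := h
    refine Or.inr (eventually_bind.2 (hmem.mono fun z hz => ?_))
    exact (meromorphicOrderAt_ne_top_iff_eventually_ne_zero (hU z hz)).1
      (hU.meromorphicOrderAt_ne_top_of_isPreconnected (isPreconnected_puncturedDisc hr) hx hz hxt)
  · push Not at h
    exact Or.inl (eventually_bind.2 (hmem.mono fun z hz => meromorphicOrderAt_eq_top_iff.1 (h z hz)))

/-- The ring of germs at `0` of functions meromorphic in a punctured neighbourhood of `0`. -/
noncomputable def merGermSubring : Subring (Germ nearZero ℂ) where
  carrier := {g | ∃ f : ℂ → ℂ, (∀ᶠ z in 𝓝[≠] (0 : ℂ), MeromorphicAt f z) ∧ g = ↑f}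
  mul_mem' := by
    rintro _ _ ⟨f, hf, rfl⟩ ⟨g, hg, rfl⟩
    exact ⟨f * g, by filter_upwards [hf, hg] with z h1 h2 using h1.mul h2, rfl⟩
  one_mem' := ⟨1, Eventually.of_forall fun z => MeromorphicAt.const 1 z, rfl⟩
  add_mem' := by
    rintro _ _ ⟨f, hf, rfl⟩ ⟨g, hg, rfl⟩
    exact ⟨f + g, by filter_upwards [hf, hg] with z h1 h2 using h1.add h2, rfl⟩
  zero_mem' := ⟨0, Eventually.of_forall fun z => MeromorphicAt.const 0 z, rfl⟩
  neg_mem' := by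
    rintro _ ⟨f, hf, rfl⟩
    exact ⟨-f, by filter_upwards [hf] with z h1 using h1.neg, rfl⟩

/-- The field of germs at `0` of functions meromorphic in a punctured neighbourhood of `0`. -/
abbrev MerGerm : Type := merGermSubring

noncomputable instance : Inv MerGerm :=
  ⟨fun g => ⟨(g : Germ nearZero ℂ)⁻¹, by
    obtain ⟨f, hf, hg⟩ := g.2
    exact ⟨f⁻¹, by filter_upwards [hf] with z h1 using h1.inv, by rw [hg]; rfl⟩⟩⟩

noncomputable instance : Field MerGerm :=
  { (inferInstance : CommRing MerGerm) with
    inv := fun g => g⁻¹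
    exists_pair_ne := ⟨0, 1, fun h => by
      have h' : ((0 : ℂ → ℂ) : Germ nearZero ℂ) = ((1 : ℂ → ℂ) : Germ nearZero ℂ) :=
        congrArg Subtype.val h
      obtain ⟨z, hz⟩ := (Germ.coe_eq.1 h').exists
      exact zero_ne_one hz⟩
    mul_inv_cancel := fun g hg => by
      obtain ⟨f, hf, hgf⟩ := g.2
      apply Subtype.ext
      change (g : Germ nearZero ℂ) * (g : Germ nearZero ℂ)⁻¹ = ((1 : ℂ → ℂ) : Germ nearZero ℂ)
      rw [hgf]
      rcases eventually_zero_or_ne_zero hf with h | h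
      · exact absurd (Subtype.ext (hgf.trans (Germ.coe_eq.2 h))) hg
      · exact Germ.coe_eq.2 (h.mono fun z hz => mul_inv_cancel₀ hz)
    inv_zero := Subtype.ext (Germ.coe_eq.2 (Eventually.of_forall fun z => inv_zero))
    nnqsmul := _
    nnqsmul_def := fun _ _ => rfl
    qsmul := _
    qsmul_def := fun _ _ => rfl }

/-! ### The operator `σ_q` -/

theorem tendsto_mul_nearZero (q : ℂˣ) : Tendsto (fun z : ℂ => (q : ℂ) * z) nearZero nearZero := by
  have key : ∀ x : ℂ, Tendsto (fun z : ℂ => (q : ℂ) * z) (𝓝[≠] x) (𝓝[≠] ((q : ℂ) * x)) := fun x =>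
    tendsto_nhdsWithin_of_tendsto_nhds_of_eventually_within _
      ((continuous_const_mul (q : ℂ)).continuousAt.tendsto.mono_left nhdsWithin_le_nhds)
      (eventually_nhdsWithin_of_forall fun z hz h => hz (mul_left_cancel₀ q.ne_zero h))
  have key0 := key 0
  rw [mul_zero] at key0
  intro S hS
  exact (key0.eventually (eventually_bind.1 hS)).mono fun z hz => (key z).eventually hz

/-- The operator `σ_q`, `(σ_q f)(z) = f (q z)`, on germs at `0` of meromorphic functions. -/
noncomputable def sigma (q : ℂˣ) : MerGerm →+* MerGerm where
  toFun g := ⟨(g : Germ nearZero ℂ).compTendsto (fun z : ℂ => (q : ℂ) * z)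
      (tendsto_mul_nearZero q), by
    obtain ⟨f, hf, hg⟩ := g.2
    refine ⟨fun z => f ((q : ℂ) * z), ?_, by rw [hg]; rfl⟩
    have h0 : Tendsto (fun z : ℂ => (q : ℂ) * z) (𝓝[≠] 0) (𝓝[≠] 0) :=
      tendsto_nhdsWithin_of_tendsto_nhds_of_eventually_within _
        (by simpa using ((continuous_const_mul (q : ℂ)).tendsto 0).mono_left nhdsWithin_le_nhds)
        (eventually_nhdsWithin_of_forall fun z hz => mul_ne_zero q.ne_zero hz)
    filter_upwards [h0.eventually hf] with z hz
    exact hz.comp_analyticAt (by fun_prop)⟩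
  map_one' := rfl
  map_zero' := rfl
  map_mul' := by
    rintro ⟨g, f, _, rfl⟩ ⟨g', f', _, rfl⟩
    rfl
  map_add' := by
    rintro ⟨g, f, _, rfl⟩ ⟨g', f', _, rfl⟩
    rfl

/-- The subfield of all `σ_q`-invariant germs. -/
noncomputable def invariants (q : ℂˣ) : Subfield MerGerm :=
  (sigma q).eqLocusField (RingHom.id MerGerm)

/-! ### Fields of meromorphic functions -/

/-- The germs at `0` of functions meromorphic on `U`. This is used for `U = ℂ`, `U = ℂ \ {0}` and
`U = {0}`; in the first two cases the identity theorem identifies a meromorphic function on `U`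
with its germ at `0`. -/
noncomputable def mer (U : Set ℂ) : Subfield MerGerm where
  carrier := {g | ∃ f : ℂ → ℂ, MeromorphicOn f U ∧ (g : Germ nearZero ℂ) = ↑f}
  mul_mem' := by
    rintro ⟨_, _⟩ ⟨_, _⟩ ⟨f, hf, rfl⟩ ⟨g, hg, rfl⟩
    exact ⟨f * g, hf.mul hg, rfl⟩
  one_mem' := ⟨1, fun z _ => MeromorphicAt.const 1 z, rfl⟩
  add_mem' := by
    rintro ⟨_, _⟩ ⟨_, _⟩ ⟨f, hf, rfl⟩ ⟨g, hg, rfl⟩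
    exact ⟨f + g, hf.add hg, rfl⟩
  zero_mem' := ⟨0, fun z _ => MeromorphicAt.const 0 z, rfl⟩
  neg_mem' := by
    rintro ⟨_, _⟩ ⟨f, hf, rfl⟩
    exact ⟨-f, hf.neg, rfl⟩
  inv_mem' := by
    rintro ⟨_, _⟩ ⟨f, hf, rfl⟩
    exact ⟨f⁻¹, hf.inv, rfl⟩

/-- `k₀ = M(ℂ)`, the field of meromorphic functions on `ℂ`. -/
noncomputable def k₀ : Subfield MerGerm := mer Set.univ

/-- `k₀' = ℂ({z})`, the field of germs of functions meromorphic at `0`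
(convergent Laurent series with finite principal part). -/
noncomputable def k₀' : Subfield MerGerm := mer {0}

/-- `M(ℂ*)`, the field of meromorphic functions on `ℂ* = ℂ \ {0}`. -/
noncomputable def merCStar : Subfield MerGerm := mer {0}ᶜ

/-- The field `M(E)` of elliptic functions, `E = ℂ / (ℤ + ℤ τ)`: the meromorphic functions `F` of
`x ∈ ℂ` with periods `1` and `τ`, regarded as functions `f` of `z = exp (2 π i x) ∈ ℂ*` (or of
its class in `ℂ* / q^ℤ`, `q = exp (-2 π i τ)`) through `f (exp (2 π i x)) = F x`. -/
noncomputable def elliptic (τ : ℂ) : Subfield MerGerm where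
  carrier := {g | ∃ F f : ℂ → ℂ, MeromorphicOn F Set.univ ∧
    (∀ x, F (x + 1) = F x) ∧ (∀ x, F (x + τ) = F x) ∧
    (∀ x, f (Complex.exp (2 * Real.pi * Complex.I * x)) = F x) ∧
    (g : Germ nearZero ℂ) = ↑f}
  mul_mem' := by
    rintro ⟨_, _⟩ ⟨_, _⟩ ⟨F, f, hF, h1, h2, h3, rfl⟩ ⟨G, g, hG, k1, k2, k3, rfl⟩
    exact ⟨F * G, f * g, hF.mul hG, fun x => by simp [h1, k1], fun x => by simp [h2, k2],
      fun x => by simp [h3, k3], rfl⟩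
  one_mem' := ⟨1, 1, fun z _ => MeromorphicAt.const 1 z, fun _ => rfl, fun _ => rfl,
    fun _ => rfl, rfl⟩
  add_mem' := by
    rintro ⟨_, _⟩ ⟨_, _⟩ ⟨F, f, hF, h1, h2, h3, rfl⟩ ⟨G, g, hG, k1, k2, k3, rfl⟩
    exact ⟨F + G, f + g, hF.add hG, fun x => by simp [h1, k1], fun x => by simp [h2, k2],
      fun x => by simp [h3, k3], rfl⟩
  zero_mem' := ⟨0, 0, fun z _ => MeromorphicAt.const 0 z, fun _ => rfl, fun _ => rfl,
    fun _ => rfl, rfl⟩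
  neg_mem' := by
    rintro ⟨_, _⟩ ⟨F, f, hF, h1, h2, h3, rfl⟩
    exact ⟨-F, -f, hF.neg, fun x => by simp [h1], fun x => by simp [h2],
      fun x => by simp [h3], rfl⟩
  inv_mem' := by
    rintro ⟨_, _⟩ ⟨F, f, hF, h1, h2, h3, rfl⟩
    exact ⟨F⁻¹, f⁻¹, hF.inv, fun x => by simp [h1], fun x => by simp [h2],
      fun x => by simp [h3], rfl⟩

/-! ### Theta function, characters, logarithm -/

/-- `Θ_q(z) = ∑_{n ∈ ℤ} (-1)^n q^{-(n² - n)/2} z^n` (the integer `n² - n` is even). -/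
noncomputable def theta (q : ℂˣ) (z : ℂ) : ℂ :=
  ∑' n : ℤ, (-1 : ℂ) ^ n * (q : ℂ) ^ (-((n ^ 2 - n) / 2)) * z ^ n

/-- `Θ_{q,c}(z) = Θ_q(c⁻¹ z)`. -/
noncomputable def thetaC (q c : ℂˣ) (z : ℂ) : ℂ := theta q ((c : ℂ)⁻¹ * z)

/-- The standard characters `e_{q,c} = Θ_q / Θ_{q,c}`. -/
noncomputable def eChar (q c : ℂˣ) (z : ℂ) : ℂ := theta q z / thetaC q c z

/-- The `q`-logarithm `l_q(z) = z Θ_q'(z) / Θ_q(z)`. -/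
noncomputable def qLog (q : ℂˣ) (z : ℂ) : ℂ := z * deriv (theta q) z / theta q z

/-- The subfield of `MerGerm` generated by a subfield `k` and the germs of the functions in `S`. -/
noncomputable def adjoinFun (k : Subfield MerGerm) (S : Set (ℂ → ℂ)) : Subfield MerGerm :=
  Subfield.closure ((k : Set MerGerm) ∪ {g | ∃ f ∈ S, (g : Germ nearZero ℂ) = ↑f})

/-- `K₀ = k₀(l_q, (e_{q,c})_{c ∈ ℂ*})`. -/
noncomputable def K₀ (q : ℂˣ) : Subfield MerGerm :=
  adjoinFun k₀ ({qLog q} ∪ Set.range (eChar q))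

/-- `K₀' = k₀'(l_q, (e_{q,c})_{c ∈ ℂ*})`. -/
noncomputable def K₀' (q : ℂˣ) : Subfield MerGerm :=
  adjoinFun k₀' ({qLog q} ∪ Set.range (eChar q))

/-- `L₀' = k₀'(Θ_q', (Θ_{q,c})_{c ∈ ℂ*})`. -/
noncomputable def L₀' (q : ℂˣ) : Subfield MerGerm :=
  adjoinFun k₀' ({deriv (theta q)} ∪ Set.range (thetaC q))

end QDiff

/-! Upper bound: since `|q⁻¹| < 1`, a `σ_q`-invariant germ extends along the orbits of `q⁻¹` from a
punctured disc to all of `ℂ*`, and its pullback by `x ↦ exp (2 π i x)` has periods `1` and `τ`.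
Hence every invariant germ is elliptic (`invariants_le_elliptic`), whatever field it was taken from,
and it only remains to show that each field contains `M(E)`.

Lower bound: a nonzero elliptic function is a quotient of theta products
(`exists_eq_thetaQuot_of_mem_elliptic`). With as many factors above as below, such a quotient is
also a quotient of products of the `e_{q,c}`.

For the factorization, the pullback `ϑ` of `Θ_q` is compared with an infinite product; the ratio is
entire and doubly periodic, hence constant, so `ϑ` has simple zeros, exactly on the lattice
(`exists_theta_eq_latticeProd`). Given an elliptic `F`, a product of powers of translates of `ϑ` has
the same divisor; the ratio `H` is entire, has no zeros and is quasi-periodic. The derivative of its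
logarithmic derivative is doubly periodic, which forces `H = l z ^ m` and total degree zero
(`exists_eq_zpow_of_quasiPeriodic`). The monomial is itself a theta quotient, and the invariance of
`F` gives `∏ a_i = ∏ b_i`. -/

namespace QDiff

/-! ### Uniformization of `ℂ*` by the exponential. -/

/-- The uniformization `x ↦ exp (2 π i x)` of `ℂ*`. -/
noncomputable def expTwoPiI (x : ℂ) : ℂ := Complex.exp (2 * Real.pi * Complex.I * x)

theorem expTwoPiI_ne_zero (x : ℂ) : expTwoPiI x ≠ 0 := Complex.exp_ne_zero _

theorem expTwoPiI_add (x y : ℂ) : expTwoPiI (x + y) = expTwoPiI x * expTwoPiI y := by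
  rw [expTwoPiI, mul_add, Complex.exp_add]; rfl

theorem expTwoPiI_zero : expTwoPiI 0 = 1 := by simp [expTwoPiI]

theorem expTwoPiI_neg (x : ℂ) : expTwoPiI (-x) = (expTwoPiI x)⁻¹ := by
  rw [expTwoPiI, mul_neg, Complex.exp_neg]; rfl

theorem expTwoPiI_sub (x y : ℂ) : expTwoPiI (x - y) = expTwoPiI x / expTwoPiI y := by
  rw [sub_eq_add_neg, expTwoPiI_add, expTwoPiI_neg]; rfl

theorem expTwoPiI_one : expTwoPiI 1 = 1 := by simp [expTwoPiI, Complex.exp_two_pi_mul_I]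

theorem expTwoPiI_int_mul (n : ℤ) (x : ℂ) : expTwoPiI (n * x) = expTwoPiI x ^ n := by
  rw [expTwoPiI, expTwoPiI, ← Complex.exp_int_mul]; congr 1; ring

theorem expTwoPiI_eq_one_iff {x : ℂ} : expTwoPiI x = 1 ↔ ∃ n : ℤ, x = n := by
  rw [expTwoPiI, Complex.exp_eq_one_iff]
  refine exists_congr fun n => ?_
  have h : (2 * Real.pi * Complex.I : ℂ) ≠ 0 := Complex.two_pi_I_ne_zero
  rw [mul_comm (n : ℂ), mul_right_inj' h]

theorem exists_expTwoPiI_eq {z : ℂ} (hz : z ≠ 0) : ∃ x, expTwoPiI x = z := by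
  refine ⟨Complex.log z / (2 * Real.pi * Complex.I), ?_⟩
  rw [expTwoPiI, mul_div_cancel₀ _ Complex.two_pi_I_ne_zero, Complex.exp_log hz]

theorem hasDerivAt_expTwoPiI (x : ℂ) :
    HasDerivAt expTwoPiI (expTwoPiI x * (2 * Real.pi * Complex.I)) x := by
  have h : HasDerivAt expTwoPiI (expTwoPiI x * (2 * Real.pi * Complex.I * 1)) x :=
    ((hasDerivAt_id x).const_mul (2 * Real.pi * Complex.I : ℂ)).cexp
  rwa [mul_one] at h

theorem differentiable_expTwoPiI : Differentiable ℂ expTwoPiI :=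
  fun x => (hasDerivAt_expTwoPiI x).differentiableAt

theorem analyticAt_expTwoPiI (x : ℂ) : AnalyticAt ℂ expTwoPiI x :=
  differentiable_expTwoPiI.analyticAt x

theorem deriv_expTwoPiI_ne_zero (x : ℂ) : deriv expTwoPiI x ≠ 0 := by
  rw [(hasDerivAt_expTwoPiI x).deriv]
  exact mul_ne_zero (expTwoPiI_ne_zero x) Complex.two_pi_I_ne_zero

/-- The exponential maps onto `ℂ*` with nowhere vanishing derivative, so meromorphy descends as well
as pulls back. -/
theorem meromorphicOn_compl_zero_iff {f : ℂ → ℂ} :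
    MeromorphicOn f {0}ᶜ ↔ Meromorphic (f ∘ expTwoPiI) := by
  constructor
  · intro h x
    exact (h _ (expTwoPiI_ne_zero x)).comp_analyticAt (analyticAt_expTwoPiI x)
  · intro h z hz
    obtain ⟨x, rfl⟩ := exists_expTwoPiI_eq hz
    exact (meromorphicAt_comp_iff_of_deriv_ne_zero (analyticAt_expTwoPiI x)
      (deriv_expTwoPiI_ne_zero x)).1 (h x)

/-- Two functions on `ℂ*` whose pullbacks to `ℂ` agree off a closed discrete set define the same
germ. -/
theorem eventuallyEq_nearZero_of_comp {f g : ℂ → ℂ}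
    (h : ∀ x, f ∘ expTwoPiI =ᶠ[𝓝[≠] x] g ∘ expTwoPiI) : f =ᶠ[nearZero] g := by
  refine eventually_bind.2 (eventually_nhdsWithin_of_forall fun z hz => ?_)
  obtain ⟨x, rfl⟩ := exists_expTwoPiI_eq hz
  -- A local homeomorphism carries neighbourhoods of `x` onto neighbourhoods of its image, and a
  -- point with a different image is different from `x`.
  have hmap : map expTwoPiI (𝓝 x) = 𝓝 (expTwoPiI x) := by
    refine HasStrictDerivAt.map_nhds_eq (f' := deriv expTwoPiI x) ?_ (deriv_expTwoPiI_ne_zero x)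
    exact (analyticAt_expTwoPiI x).hasStrictDerivAt
  rw [eventually_nhdsWithin_iff, ← hmap, eventually_map]
  refine (eventually_nhdsWithin_iff.1 (h x)).mono fun w hw hne => hw ?_
  rintro rfl
  exact hne rfl

theorem eventually_nearZero_ne_zero : ∀ᶠ z in nearZero, z ≠ 0 :=
  eventually_bind.2 (eventually_nhdsWithin_of_forall fun _ hz =>
    (continuous_id.continuousAt.eventually_ne hz).filter_mono nhdsWithin_le_nhds)

/-! ### Lattice periodicity -/

section Lattice
variable {τ : ℂ}

theorem apply_add_lattice {α : Type*} {f : ℂ → α} (h1 : ∀ x, f (x + 1) = f x)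
    (hτ : ∀ x, f (x + τ) = f x) (m n : ℤ) (x : ℂ) : f (x + (m + n * τ)) = f x := by
  have p1 : Function.Periodic f 1 := h1
  have pτ : Function.Periodic f τ := hτ
  rw [← add_assoc, pτ.int_mul n, ← mul_one (m : ℂ), p1.int_mul m]

theorem exists_eq_add_lattice (hτ : 0 < τ.im) (x : ℂ) :
    ∃ s ∈ Set.Ico (0 : ℝ) 1, ∃ t ∈ Set.Ico (0 : ℝ) 1, ∃ m n : ℤ,
      x = (s + t * τ) + (m + n * τ) := by
  set t := x.im / τ.im with ht
  set s := x.re - t * τ.re with hs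
  refine ⟨Int.fract s, ⟨Int.fract_nonneg _, Int.fract_lt_one _⟩, Int.fract t,
    ⟨Int.fract_nonneg _, Int.fract_lt_one _⟩, ⌊s⌋, ⌊t⌋, ?_⟩
  have e1 : ((Int.fract s : ℝ) : ℂ) + (⌊s⌋ : ℂ) = s := by
    rw [← Complex.ofReal_intCast, ← Complex.ofReal_add, Int.fract_add_floor]
  have e2 : ((Int.fract t : ℝ) : ℂ) + (⌊t⌋ : ℂ) = t := by
    rw [← Complex.ofReal_intCast, ← Complex.ofReal_add, Int.fract_add_floor]
  have e3 : x = s + t * τ := by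
    apply Complex.ext
    · simp [hs]
    · simp [ht, hτ.ne']
  calc x = s + t * τ := e3
    _ = _ := by rw [← e1, ← e2]; ring

/-- The closed fundamental parallelogram of `ℤ + ℤ τ`. -/
def parallelogram (τ : ℂ) : Set ℂ :=
  (fun p : ℝ × ℝ => (p.1 : ℂ) + p.2 * τ) '' (Set.Icc 0 1 ×ˢ Set.Icc 0 1)

theorem isCompact_parallelogram (τ : ℂ) : IsCompact (parallelogram τ) :=
  (isCompact_Icc.prod isCompact_Icc).image (by fun_prop)

/-- A doubly periodic entire function is constant. -/
theorem apply_eq_apply_of_doublyPeriodic (hτ : 0 < τ.im) {f : ℂ → ℂ} (hf : Differentiable ℂ f)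
    (h1 : ∀ x, f (x + 1) = f x) (h2 : ∀ x, f (x + τ) = f x) (x y : ℂ) : f x = f y := by
  refine hf.apply_eq_apply_of_bounded (((isCompact_parallelogram τ).image
    hf.continuous).isBounded.subset ?_) x y
  rintro _ ⟨w, rfl⟩
  obtain ⟨s, hs, t, ht, m, n, rfl⟩ := exists_eq_add_lattice hτ w
  refine ⟨s + t * τ, ⟨(s, t), ⟨⟨hs.1, hs.2.le⟩, ⟨ht.1, ht.2.le⟩⟩, rfl⟩, ?_⟩
  rw [apply_add_lattice h1 h2]

theorem lattice_eq_iff (hτ : 0 < τ.im) {s t s' t' : ℝ} :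
    (s + t * τ : ℂ) = s' + t' * τ ↔ s = s' ∧ t = t' := by
  refine ⟨fun h => ?_, by rintro ⟨rfl, rfl⟩; rfl⟩
  have him := congrArg Complex.im h
  have hre := congrArg Complex.re h
  simp at him hre
  have ht : t = t' := him.resolve_right hτ.ne'
  subst ht
  exact ⟨by linarith, rfl⟩

end Lattice

/-! ### Regularization of meromorphic functions -/

/-- The meromorphic normal form corrects the values at removable singularities. The last clause
later makes quotients of functions with equal divisors zero-free. -/
theorem exists_entire_of_meromorphicOrderAt_nonneg {F : ℂ → ℂ} (hF : Meromorphic F)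
    (h : ∀ x, 0 ≤ meromorphicOrderAt F x) :
    ∃ G : ℂ → ℂ, Differentiable ℂ G ∧ (∀ x, F =ᶠ[𝓝[≠] x] G) ∧
      ∀ x, meromorphicOrderAt F x = 0 → G x ≠ 0 := by
  have hU : MeromorphicOn F Set.univ := hF.meromorphicOn
  have hNF := meromorphicNFOn_toMeromorphicNFOn F Set.univ
  have hord : ∀ x, meromorphicOrderAt (toMeromorphicNFOn F Set.univ) x = meromorphicOrderAt F x :=
    fun x => meromorphicOrderAt_toMeromorphicNFOn hU (Set.mem_univ x)
  refine ⟨toMeromorphicNFOn F Set.univ, fun x => ?_, fun x => ?_, fun x hx => ?_⟩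
  · refine AnalyticAt.differentiableAt ?_
    exact (hNF (Set.mem_univ x)).meromorphicOrderAt_nonneg_iff_analyticAt.1 (by rw [hord]; exact h x)
  · exact (hU.toMeromorphicNFOn_eq_self_on_nhdsNE (Set.mem_univ x)).symm
  · exact (hNF (Set.mem_univ x)).meromorphicOrderAt_eq_zero_iff.1 (by rw [hord]; exact hx)

theorem eq_of_eventuallyEq_nhdsNE {f g : ℂ → ℂ} {x : ℂ} (hf : ContinuousAt f x)
    (hg : ContinuousAt g x) (h : f =ᶠ[𝓝[≠] x] g) : f x = g x :=
  tendsto_nhds_unique_of_eventuallyEq (hf.tendsto.mono_left nhdsWithin_le_nhds)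
    (hg.tendsto.mono_left nhdsWithin_le_nhds) h

theorem tendsto_add_nhdsNE (x a : ℂ) : Tendsto (fun y => y + a) (𝓝[≠] x) (𝓝[≠] (x + a)) :=
  tendsto_nhdsWithin_of_tendsto_nhds_of_eventually_within _
    ((continuous_add_const a).continuousAt.tendsto.mono_left nhdsWithin_le_nhds)
    (eventually_nhdsWithin_of_forall fun _ hy h => hy (add_right_cancel h))

theorem quasiPeriodic_of_eventuallyEq {F G u : ℂ → ℂ} {a : ℂ} (hG : Continuous G)
    (hu : Continuous u) (hFG : ∀ x, F =ᶠ[𝓝[≠] x] G) (hF : ∀ x, F (x + a) = u x * F x) (x : ℂ) :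
    G (x + a) = u x * G x := by
  refine eq_of_eventuallyEq_nhdsNE (f := fun x => G (x + a)) (g := fun x => u x * G x)
    (by fun_prop) (by fun_prop) ?_
  filter_upwards [hFG x, (tendsto_add_nhdsNE x a).eventually (hFG (x + a))] with y h1 h2
  rw [← h1, ← h2, hF]

theorem meromorphicOrderAt_add_of_quasiPeriodic {F u : ℂ → ℂ} {a x : ℂ}
    (hu : AnalyticAt ℂ u x) (hu0 : u x ≠ 0) (hF : ∀ x, F (x + a) = u x * F x) :
    meromorphicOrderAt F (x + a) = meromorphicOrderAt F x := by
  rw [← meromorphicOrderAt_comp_add_const_eq_meromorphicOrderAt]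
  rw [show F ∘ (fun y => y + a) = u * F from funext hF, meromorphicOrderAt_mul_of_ne_zero hu hu0]

/-! ### Zero-free entire functions with theta-like quasi-periods. -/

variable {τ : ℂ} {q : ℂˣ}

/-- A nowhere vanishing entire function with the quasi-periods of a power of `ϑ` is an
exponential, and the power is zero. -/
theorem exists_eq_zpow_of_quasiPeriodic (hτ : 0 < τ.im) {H : ℂ → ℂ} (hH : Differentiable ℂ H)
    (h0 : ∀ x, H x ≠ 0) (h1 : ∀ x, H (x + 1) = H x) (c : ℂ) (k : ℤ) (hc : c ≠ 0)
    (h2 : ∀ x, H (x + τ) = c * expTwoPiI x ^ k * H x) :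
    k = 0 ∧ ∃ (l : ℂ) (m : ℤ), l ≠ 0 ∧ ∀ x, H x = l * expTwoPiI x ^ m := by
  -- The logarithmic derivative turns the multiplier `c z ^ k` into the additive constant `2 π i k`,
  -- so `L'` is doubly periodic and `L` is affine.
  set L : ℂ → ℂ := fun x => deriv H x / H x with hL
  have hdH : Differentiable ℂ (deriv H) := fun x => (hH.analyticAt x).deriv.differentiableAt
  have hLd : Differentiable ℂ L := hdH.div hH h0
  have hL1 : ∀ x, L (x + 1) = L x := by
    intro x
    have : deriv H (x + 1) = deriv H x := by
      rw [← deriv_comp_add_const]; congr 1; ext y; exact h1 y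
    simp only [hL, this, h1]
  have hu : ∀ x, HasDerivAt (fun x => c * expTwoPiI x ^ k)
      (c * expTwoPiI x ^ k * (k * (2 * Real.pi * Complex.I))) x := by
    intro x
    have := ((hasDerivAt_zpow k (expTwoPiI x) (Or.inl (expTwoPiI_ne_zero x))).comp x
      (hasDerivAt_expTwoPiI x)).const_mul c
    refine this.congr_deriv ?_
    rw [zpow_sub_one₀ (expTwoPiI_ne_zero x)]
    field_simp [expTwoPiI_ne_zero x]
  have hLτ : ∀ x, L (x + τ) = L x + k * (2 * Real.pi * Complex.I) := by
    intro x
    have e : deriv H (x + τ) = c * expTwoPiI x ^ k * (k * (2 * Real.pi * Complex.I)) * H x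
        + c * expTwoPiI x ^ k * deriv H x := by
      rw [← deriv_comp_add_const]
      have : (fun y => H (y + τ)) = fun y => c * expTwoPiI y ^ k * H y := by ext y; exact h2 y
      rw [this]
      exact ((hu x).mul (hH x).hasDerivAt).deriv
    simp only [hL, e, h2]
    have h3 := zpow_ne_zero k (expTwoPiI_ne_zero x)
    have h4 := h0 x
    field_simp
    ring
  have hLdd : Differentiable ℂ (deriv L) := fun x => (hLd.analyticAt x).deriv.differentiableAt
  have hconst : ∀ x, deriv L x = deriv L 0 := fun x => by
    refine apply_eq_apply_of_doublyPeriodic hτ hLdd (fun x => ?_) (fun x => ?_) x 0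
    · rw [← deriv_comp_add_const]; congr 1; ext y; exact hL1 y
    · rw [← deriv_comp_add_const]
      have : (fun y => L (y + τ)) = fun y => L y + k * (2 * Real.pi * Complex.I) := by
        ext y; exact hLτ y
      rw [this, deriv_add_const]
  have haff : ∀ x, L x = deriv L 0 * x + L 0 := by
    intro x
    have hd : Differentiable ℂ fun x => L x - deriv L 0 * x := by fun_prop
    have := is_const_of_deriv_eq_zero hd (fun x => by
      have : HasDerivAt (fun x => L x - deriv L 0 * x) (deriv L x - deriv L 0 * 1) x :=
        (hLd x).hasDerivAt.sub ((hasDerivAt_id x).const_mul _)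
      rw [this.deriv, hconst x]; ring) x 0
    simp only [mul_zero, sub_zero] at this
    linear_combination this
  -- Period `1` kills the slope; the constant `L` then has increment zero along `τ`, whence `k = 0`.
  have hα : deriv L 0 = 0 := by
    have := hL1 0
    rw [haff (0 + 1)] at this
    linear_combination this
  have hLc : ∀ x, L x = L 0 := fun x => by rw [haff x, hα]; ring
  have hk : k = 0 := by
    have := hLτ 0
    rw [hLc (0 + τ), left_eq_add] at this
    rcases mul_eq_zero.1 this with h | h
    · exact_mod_cast h
    · exact absurd h Complex.two_pi_I_ne_zero
  have hexp : ∀ x, H x = H 0 * Complex.exp (L 0 * x) := by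
    intro x
    have hd : ∀ x, HasDerivAt (fun x => H x * Complex.exp (-(L 0 * x)))
        (deriv H x * Complex.exp (-(L 0 * x)) +
          H x * (Complex.exp (-(L 0 * x)) * (-(L 0 * 1)))) x := fun x =>
      (hH x).hasDerivAt.mul (((hasDerivAt_id x).const_mul (L 0)).neg.cexp)
    have := is_const_of_deriv_eq_zero (fun x => (hd x).differentiableAt) (fun x => by
      rw [(hd x).deriv]
      have hx : deriv H x = L 0 * H x := by rw [← hLc x]; exact (div_mul_cancel₀ _ (h0 x)).symm
      rw [hx]; ring) x 0
    simp only [mul_zero, neg_zero, Complex.exp_zero, mul_one] at this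
    rw [← this, mul_assoc, ← Complex.exp_add]; simp
  have hper : Complex.exp (L 0) = 1 := by
    have h := h1 0
    rw [hexp (0 + 1)] at h
    simpa [h0 0] using h
  obtain ⟨m, hm⟩ := Complex.exp_eq_one_iff.1 hper
  refine ⟨hk, H 0, m, h0 0, fun x => ?_⟩
  rw [hexp x, ← expTwoPiI_int_mul, hm, expTwoPiI]
  congr 2; ring

/-! ### The infinite product with simple zeros on the lattice -/

/-- The `q`-Pochhammer product `∏_{n ≥ 0} (1 - p ^ n z)`. -/
noncomputable def pochhammerInf (p z : ℂ) : ℂ := ∏' n : ℕ, (1 - p ^ n * z)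

theorem summable_norm_pow_mul {p : ℂ} (hp : ‖p‖ < 1) (z : ℂ) :
    Summable fun n : ℕ => ‖-(p ^ n * z)‖ := by
  simpa using (summable_geometric_of_lt_one (norm_nonneg _) hp).mul_right ‖z‖

theorem differentiable_pochhammerInf {p : ℂ} (hp : ‖p‖ < 1) :
    Differentiable ℂ (pochhammerInf p) := by
  have : HasProdLocallyUniformlyOn (fun (n : ℕ) z => 1 + -(p ^ n * z))
      (fun z => ∏' n : ℕ, (1 + -(p ^ n * z))) Set.univ := by
    apply hasProdLocallyUniformlyOn_of_forall_compact isOpen_univ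
    intro K _ hK
    obtain ⟨R, hR⟩ := hK.isBounded.exists_norm_le
    refine ((summable_geometric_of_lt_one (norm_nonneg _) hp).mul_right
      R).hasProdUniformlyOn_nat_one_add hK (.of_forall fun n z hz => ?_) (fun _ => by fun_prop)
    rw [norm_neg, norm_mul, norm_pow]
    exact mul_le_mul_of_nonneg_left (hR z hz) (by positivity)
  have hd := this.differentiableOn (.of_forall fun _ => by
    simpa [Finset.prod_fn] using DifferentiableOn.finsetProd (fun _ _ => by fun_prop)) isOpen_univ
  have hd' := differentiableOn_univ.1 hd
  simpa only [← sub_eq_add_neg] using! hd'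

theorem pochhammerInf_eq {p : ℂ} (hp : ‖p‖ < 1) (z : ℂ) :
    pochhammerInf p z = (1 - z) * pochhammerInf p (p * z) := by
  have hm : Multipliable fun n : ℕ => (1 + -(p ^ n * (p * z))) :=
    multipliable_one_add_of_summable (summable_norm_pow_mul hp (p * z))
  have e : (fun n : ℕ => (1 + -(p ^ n * (p * z)))) = fun n : ℕ => (1 - p ^ (n + 1) * z) := by
    ext n; ring
  rw [e] at hm
  rw [pochhammerInf, tprod_eq_zero_mul' (f := fun n : ℕ => 1 - p ^ n * z) hm, pochhammerInf]
  simp [pow_succ, mul_assoc]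

theorem pochhammerInf_ne_zero {p : ℂ} (hp : ‖p‖ < 1) {z : ℂ} (h : ∀ n : ℕ, p ^ n * z ≠ 1) :
    pochhammerInf p z ≠ 0 := by
  have := tprod_one_add_ne_zero_of_summable (f := fun n : ℕ => -(p ^ n * z))
    (fun n => by rw [← sub_eq_add_neg]; exact sub_ne_zero.2 (h n).symm)
    (summable_norm_pow_mul hp z)
  simpa only [pochhammerInf, sub_eq_add_neg] using! this

/-- A product with simple zeros on `ℤ + ℤ τ` and the quasi-periods of the theta function. -/
noncomputable def latticeProd (τ x : ℂ) : ℂ :=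
  pochhammerInf (expTwoPiI τ) (expTwoPiI x) * pochhammerInf (expTwoPiI τ) (expTwoPiI (τ - x))

theorem norm_expTwoPiI_lt_one (hτ : 0 < τ.im) : ‖expTwoPiI τ‖ < 1 := by
  rw [expTwoPiI, Complex.norm_exp, Real.exp_lt_one_iff]
  simpa using by positivity

theorem differentiable_latticeProd (hτ : 0 < τ.im) : Differentiable ℂ (latticeProd τ) := by
  have h1 := differentiable_pochhammerInf (norm_expTwoPiI_lt_one hτ)
  exact (h1.comp differentiable_expTwoPiI).mul
    (h1.comp (differentiable_expTwoPiI.comp (by fun_prop)))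

theorem latticeProd_add_one (x : ℂ) : latticeProd τ (x + 1) = latticeProd τ x := by
  rw [latticeProd, latticeProd, expTwoPiI_sub, expTwoPiI_add, expTwoPiI_one, mul_one, expTwoPiI_sub]

/-- With `z = exp (2 π i x)`, the shift removes the factor `1 - z` from one product and adds `1 -
z⁻¹` to the other; their ratio is `-z⁻¹`, the multiplier of `ϑ`. -/
theorem latticeProd_add_period (hτ : 0 < τ.im) (x : ℂ) :
    latticeProd τ (x + τ) = -(expTwoPiI x)⁻¹ * latticeProd τ x := by
  have hp := norm_expTwoPiI_lt_one hτ
  have e1 := pochhammerInf_eq hp (expTwoPiI x)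
  have e2 := pochhammerInf_eq hp (expTwoPiI (-x))
  rw [← expTwoPiI_add] at e1 e2
  rw [latticeProd, latticeProd, e1, add_comm x τ, show τ - (τ + x) = -x by ring, e2,
    show τ + -x = τ - x by ring, expTwoPiI_neg]
  have := expTwoPiI_ne_zero x
  field_simp
  ring

theorem pochhammerInf_expTwoPiI_ne_zero (hτ : 0 < τ.im) {x : ℂ}
    (h : ∀ m n : ℤ, x ≠ m + n * τ) : pochhammerInf (expTwoPiI τ) (expTwoPiI x) ≠ 0 := by
  refine pochhammerInf_ne_zero (norm_expTwoPiI_lt_one hτ) fun n hn => ?_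
  have h3 : expTwoPiI ((n : ℤ) * τ + x) = 1 := by
    rw [expTwoPiI_add, expTwoPiI_int_mul]; exact_mod_cast hn
  obtain ⟨m, hm⟩ := expTwoPiI_eq_one_iff.1 h3
  refine h m (-n) ?_
  push_cast at hm ⊢
  linear_combination hm

theorem latticeProd_ne_zero (hτ : 0 < τ.im) {x : ℂ} (h : ∀ m n : ℤ, x ≠ m + n * τ) :
    latticeProd τ x ≠ 0 := by
  refine mul_ne_zero (pochhammerInf_expTwoPiI_ne_zero hτ h)
    (pochhammerInf_expTwoPiI_ne_zero hτ fun m n hmn => h (-m) (1 - n) ?_)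
  push_cast
  linear_combination -hmn

theorem pochhammerInf_self_ne_zero (hτ : 0 < τ.im) :
    pochhammerInf (expTwoPiI τ) (expTwoPiI τ) ≠ 0 := by
  have hp := norm_expTwoPiI_lt_one hτ
  refine pochhammerInf_ne_zero hp fun n hn => ?_
  rw [← pow_succ] at hn
  have := congrArg norm hn
  rw [norm_pow, norm_one] at this
  exact (pow_lt_one₀ (norm_nonneg _) hp n.succ_ne_zero).ne this

theorem meromorphicOrderAt_latticeProd_zero (hτ : 0 < τ.im) :
    meromorphicOrderAt (latticeProd τ) 0 = 1 := by
  have hp := norm_expTwoPiI_lt_one hτ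
  have hd := differentiable_pochhammerInf hp
  -- `R` is the product without the factor `1 - z`, the only one that vanishes at `x = 0`.
  set R : ℂ → ℂ := fun x => pochhammerInf (expTwoPiI τ) (expTwoPiI (τ + x)) *
    pochhammerInf (expTwoPiI τ) (expTwoPiI (τ - x)) with hR
  have hRd : Differentiable ℂ R := (hd.comp (differentiable_expTwoPiI.comp (by fun_prop))).mul
    (hd.comp (differentiable_expTwoPiI.comp (by fun_prop)))
  have hfac : latticeProd τ = (fun x => 1 - expTwoPiI x) * R := by
    ext x
    have e1 := pochhammerInf_eq hp (expTwoPiI x)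
    rw [← expTwoPiI_add] at e1
    simp only [latticeProd, hR, Pi.mul_apply, e1, mul_assoc]
  have hR0 : R 0 ≠ 0 := by
    simp only [hR, add_zero, sub_zero]
    exact mul_ne_zero (pochhammerInf_self_ne_zero hτ) (pochhammerInf_self_ne_zero hτ)
  rw [hfac, mul_comm, meromorphicOrderAt_mul_of_ne_zero (hRd.analyticAt 0) hR0]
  have hg : AnalyticAt ℂ (fun x => 1 - expTwoPiI x) 0 :=
    analyticAt_const.sub (analyticAt_expTwoPiI 0)
  rw [hg.meromorphicOrderAt_eq]
  have : analyticOrderAt (fun x => 1 - expTwoPiI x) 0 = 1 := by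
    refine hg.analyticOrderAt_eq_one_of_zero_deriv_ne_zero (by simp [expTwoPiI_zero]) ?_
    rw [deriv_const_sub]
    exact neg_ne_zero.2 (deriv_expTwoPiI_ne_zero 0)
  rw [this]; rfl

theorem meromorphicOrderAt_add_lattice {F u : ℂ → ℂ} (hu : ∀ x, AnalyticAt ℂ u x)
    (hu0 : ∀ x, u x ≠ 0) (h1 : ∀ x, F (x + 1) = F x) (h2 : ∀ x, F (x + τ) = u x * F x)
    (m n : ℤ) (x : ℂ) :
    meromorphicOrderAt F (x + (m + n * τ)) = meromorphicOrderAt F x := by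
  refine apply_add_lattice (f := meromorphicOrderAt F) (fun x => ?_) (fun x => ?_) m n x
  · exact meromorphicOrderAt_add_of_quasiPeriodic (u := 1) analyticAt_const (by simp)
      (by simpa using h1)
  · exact meromorphicOrderAt_add_of_quasiPeriodic (hu x) (hu0 x) h2

/-! ### The theta function -/

theorem zpow_unit_eq (hq : (q : ℂ) = expTwoPiI (-τ)) (k : ℤ) :
    (q : ℂ) ^ (-k) = expTwoPiI (k * τ) := by
  rw [hq, ← expTwoPiI_int_mul]; congr 1; push_cast; ring

theorem neg_one_zpow_eq (n : ℤ) : (-1 : ℂ) ^ n = expTwoPiI (n * (1 / 2)) := by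
  rw [expTwoPiI_int_mul]
  congr 1
  rw [expTwoPiI, show (2 * Real.pi * Complex.I * (1 / 2) : ℂ) = Real.pi * Complex.I by ring,
    Complex.exp_pi_mul_I]

/-- The shift by `1 / 2` produces the sign `(-1) ^ n`, and the shift by `-τ / 2` the linear part of
the exponent `(n² - n) / 2`. -/
theorem theta_term_eq (hq : (q : ℂ) = expTwoPiI (-τ)) (n : ℤ) (x : ℂ) :
    (-1 : ℂ) ^ n * (q : ℂ) ^ (-((n ^ 2 - n) / 2)) * expTwoPiI x ^ n =
      jacobiTheta₂_term n (x - τ / 2 + 1 / 2) τ := by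
  obtain ⟨k, hk⟩ : ∃ k, n ^ 2 - n = 2 * k := by
    have : Even (n * (n - 1)) := Int.even_mul_pred_self n
    obtain ⟨k, hk⟩ := this.two_dvd
    exact ⟨k, by linarith [hk, sq n, mul_sub n n 1]⟩
  have hkC : (n : ℂ) ^ 2 - n = 2 * k := by exact_mod_cast hk
  rw [hk, Int.mul_ediv_cancel_left _ two_ne_zero, zpow_unit_eq hq, neg_one_zpow_eq,
    ← expTwoPiI_int_mul, ← expTwoPiI_add, ← expTwoPiI_add, expTwoPiI, jacobiTheta₂_term]
  congr 1
  linear_combination (-(Real.pi * Complex.I * τ)) * hkC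

theorem theta_expTwoPiI (hq : (q : ℂ) = expTwoPiI (-τ)) (x : ℂ) :
    theta q (expTwoPiI x) = jacobiTheta₂ (x - τ / 2 + 1 / 2) τ := by
  simp only [theta, theta_term_eq hq, jacobiTheta₂]

theorem differentiable_theta_comp (hτ : 0 < τ.im) (hq : (q : ℂ) = expTwoPiI (-τ)) :
    Differentiable ℂ (theta q ∘ expTwoPiI) := by
  have : theta q ∘ expTwoPiI = fun x => jacobiTheta₂ (x - τ / 2 + 1 / 2) τ :=
    funext (theta_expTwoPiI hq)
  rw [this]
  intro x
  exact (differentiableAt_jacobiTheta₂_fst (x - τ / 2 + 1 / 2) hτ).comp x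
    (f := fun x => x - τ / 2 + 1 / 2) (by fun_prop)

/-- Replacing `n` by `n + 1` raises `(n² - n) / 2` by `n`, which cancels the `q ^ n` coming from `(q
z) ^ n`; the identity holds term by term. -/
theorem theta_mul (q : ℂˣ) {z : ℂ} (hz : z ≠ 0) :
    theta q (q * z) = -(q * z) * theta q z := by
  rw [theta, theta, ← tsum_mul_left, ← (Equiv.addRight (1 : ℤ)).tsum_eq]
  refine tsum_congr fun n => ?_
  obtain ⟨k, hk⟩ : ∃ k, n ^ 2 - n = 2 * k := by
    have : Even (n * (n - 1)) := Int.even_mul_pred_self n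
    obtain ⟨k, hk⟩ := this.two_dvd
    exact ⟨k, by linarith [hk, sq n, mul_sub n n 1]⟩
  have hk' : (n + 1) ^ 2 - (n + 1) = 2 * (k + n) := by linear_combination hk
  have hq0 := q.ne_zero
  simp only [Equiv.coe_addRight]
  rw [hk, hk', Int.mul_ediv_cancel_left _ two_ne_zero, Int.mul_ediv_cancel_left _ two_ne_zero,
    mul_zpow, zpow_add_one₀ (by norm_num), zpow_add_one₀ hz, zpow_add_one₀ hq0,
    show -(k + n) = -k + -n by ring, zpow_add₀ hq0, zpow_neg _ n]
  have := zpow_ne_zero n hq0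
  field_simp

theorem theta_comp_add_one (x : ℂ) :
    (theta q ∘ expTwoPiI) (x + 1) = (theta q ∘ expTwoPiI) x := by
  simp [expTwoPiI_add, expTwoPiI_one]

theorem expTwoPiI_add_period (hq : (q : ℂ) = expTwoPiI (-τ)) (x : ℂ) :
    q * expTwoPiI (x + τ) = expTwoPiI x := by
  rw [hq, ← expTwoPiI_add]; congr 1; ring

theorem theta_comp_add_period (hq : (q : ℂ) = expTwoPiI (-τ)) (x : ℂ) :
    (theta q ∘ expTwoPiI) (x + τ) = -(expTwoPiI x)⁻¹ * (theta q ∘ expTwoPiI) x := by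
  have h := theta_mul q (expTwoPiI_ne_zero (x + τ))
  rw [expTwoPiI_add_period hq] at h
  have h0 := expTwoPiI_ne_zero x
  simp only [Function.comp_apply, h]
  field_simp

/-- The involution `n ↦ 1 - n` preserves `n² - n` and reverses the sign, so the sum is its own
negative. -/
theorem theta_one (q : ℂˣ) : theta q 1 = 0 := by
  have h : theta q 1 = -theta q 1 := by
    conv_lhs => rw [theta, ← (Equiv.subLeft (1 : ℤ)).tsum_eq]
    rw [theta, ← tsum_neg]
    refine tsum_congr fun n => ?_
    simp only [Equiv.subLeft_apply, one_zpow, mul_one]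
    rw [show (1 - n) ^ 2 - (1 - n) = n ^ 2 - n by ring, zpow_sub₀ (by norm_num), zpow_one]
    have hn : (-1 : ℂ) ^ n * (-1) ^ n = 1 := by rw [← mul_zpow]; simp
    rw [div_eq_mul_inv, inv_eq_of_mul_eq_one_left hn]
    ring
  linear_combination h / 2

/-- The theta series does not vanish identically: its constant coefficient is `1`. -/
theorem exists_theta_comp_ne_zero (hτ : 0 < τ.im) (hq : (q : ℂ) = expTwoPiI (-τ)) :
    ∃ x, (theta q ∘ expTwoPiI) x ≠ 0 := by
  by_contra! hzero
  set a : ℤ → ℂ := fun n => (-1 : ℂ) ^ n * (q : ℂ) ^ (-((n ^ 2 - n) / 2)) with ha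
  have hsum : ∀ x, HasSum (fun n => a n * expTwoPiI x ^ n) 0 := fun x => by
    have h := hasSum_jacobiTheta₂_term (x - τ / 2 + 1 / 2) hτ
    rw [← theta_expTwoPiI hq, show theta q (expTwoPiI x) = 0 from hzero x] at h
    simpa only [ha, theta_term_eq hq] using h
  have hnorm : ∀ (t : ℝ) (n : ℤ), ‖a n * expTwoPiI t ^ n‖ = ‖a n‖ := fun t n => by
    have : ‖expTwoPiI t‖ = 1 := by
      rw [expTwoPiI, show (2 * Real.pi * Complex.I * t : ℂ) = (2 * Real.pi * t : ℝ) * Complex.I by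
        push_cast; ring, Complex.norm_exp_ofReal_mul_I]
    rw [norm_mul, norm_zpow, this, one_zpow, mul_one]
  have hasum : Summable fun n => ‖a n‖ := by
    simpa only [hnorm] using (hsum ((0 : ℝ) : ℂ)).summable.norm
  have hcont : ∀ n : ℤ, Continuous fun t : ℝ => a n * expTwoPiI t ^ n := fun n =>
    continuous_const.mul (((differentiable_expTwoPiI.continuous.comp
      Complex.continuous_ofReal)).zpow₀ n fun t => Or.inl (expTwoPiI_ne_zero _))
  -- Termwise integration over the unit circle, dominated by `‖a n‖`, retains only the constant
  -- coefficient `1`, while the sum integrates to `0`.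
  have hint := intervalIntegral.hasSum_integral_of_dominated_convergence
    (μ := MeasureTheory.volume) (a := 0) (b := 1)
    (F := fun (n : ℤ) (t : ℝ) => a n * expTwoPiI t ^ n) (f := fun _ => (0 : ℂ))
    (fun n _ => ‖a n‖) (fun n => (hcont n).aestronglyMeasurable)
    (fun n => Eventually.of_forall fun t _ => (hnorm t n).le)
    (Eventually.of_forall fun t _ => hasum) (by simp)
    (Eventually.of_forall fun t _ => hsum t)
  have hterm : ∀ n : ℤ, ∫ t in (0 : ℝ)..1, a n * expTwoPiI t ^ n = if n = 0 then 1 else 0 := by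
    intro n
    split_ifs with hn
    · subst hn; simp [ha]
    · have hc : (n * (2 * Real.pi * Complex.I) : ℂ) ≠ 0 :=
        mul_ne_zero (by exact_mod_cast hn) Complex.two_pi_I_ne_zero
      have e : ∀ t : ℝ, a n * expTwoPiI t ^ n =
          a n * Complex.exp (n * (2 * Real.pi * Complex.I) * t) := fun t => by
        rw [← expTwoPiI_int_mul, expTwoPiI]; congr 2; ring
      simp only [e]
      rw [intervalIntegral.integral_const_mul, integral_exp_mul_complex hc]
      simp [Complex.exp_int_mul_two_pi_mul_I]
  simp only [hterm, intervalIntegral.integral_zero] at hint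
  exact one_ne_zero ((hasSum_ite_eq (0 : ℤ) (1 : ℂ)).unique hint)

theorem meromorphicOrderAt_latticeProd_lattice (hτ : 0 < τ.im) (m n : ℤ) :
    meromorphicOrderAt (latticeProd τ) (m + n * τ) = 1 := by
  rw [← meromorphicOrderAt_latticeProd_zero hτ, ← zero_add ((m : ℂ) + n * τ)]
  exact meromorphicOrderAt_add_lattice
    (fun x => ((analyticAt_expTwoPiI x).inv (expTwoPiI_ne_zero x)).neg)
    (fun x => neg_ne_zero.2 (inv_ne_zero (expTwoPiI_ne_zero x))) latticeProd_add_one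
    (latticeProd_add_period hτ) m n 0

theorem theta_comp_lattice (hq : (q : ℂ) = expTwoPiI (-τ)) (m n : ℤ) :
    (theta q ∘ expTwoPiI) (m + n * τ) = 0 := by
  have h := apply_add_lattice (f := fun x => (theta q ∘ expTwoPiI) x = 0) (τ := τ)
    (fun x => by simp only [theta_comp_add_one]) (fun x => by
      simp only [theta_comp_add_period hq, mul_eq_zero, neg_eq_zero, inv_eq_zero,
        expTwoPiI_ne_zero, false_or]) m n 0
  rw [zero_add] at h
  rw [h, Function.comp_apply, expTwoPiI_zero, theta_one]

theorem meromorphicOrderAt_ne_top_of_exists {F : ℂ → ℂ} (hF : Meromorphic F) {x : ℂ}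
    (hx : meromorphicOrderAt F x ≠ ⊤) (y : ℂ) : meromorphicOrderAt F y ≠ ⊤ :=
  (hF.meromorphicOn (s := Set.univ)).meromorphicOrderAt_ne_top_of_isPreconnected
    isPreconnected_univ (Set.mem_univ _) (Set.mem_univ _) hx

/-- The Jacobi triple product, up to the value of the constant. -/
theorem exists_theta_eq_latticeProd (hτ : 0 < τ.im) (hq : (q : ℂ) = expTwoPiI (-τ)) :
    ∃ c : ℂ, c ≠ 0 ∧ ∀ x, (theta q ∘ expTwoPiI) x = c * latticeProd τ x := by
  have hϑ := differentiable_theta_comp hτ hq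
  have hP := differentiable_latticeProd hτ
  set ϑ := theta q ∘ expTwoPiI
  have hϑτ : ∀ x, ϑ (x + τ) = -(expTwoPiI x)⁻¹ * ϑ x := theta_comp_add_period hq
  -- The zeros of the product are simple and `ϑ` vanishes at each of them. Neither the simplicity
  -- nor the location of the zeros of `ϑ` is known yet, and order `⊤` must still be allowed.
  have hord : ∀ x, 0 ≤ meromorphicOrderAt (ϑ / latticeProd τ) x := by
    intro x
    rw [meromorphicOrderAt_div (hϑ.analyticAt x).meromorphicAt (hP.analyticAt x).meromorphicAt]
    by_cases hx : ∃ m n : ℤ, x = m + n * τ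
    · obtain ⟨m, n, rfl⟩ := hx
      rw [meromorphicOrderAt_latticeProd_lattice hτ, (hϑ.analyticAt _).meromorphicOrderAt_eq]
      have h1 : analyticOrderAt ϑ (m + n * τ) ≠ 0 :=
        (hϑ.analyticAt _).analyticOrderAt_ne_zero.2 (theta_comp_lattice hq m n)
      generalize analyticOrderAt ϑ (m + n * τ) = o at h1
      cases o with
      | top => simp
      | coe k =>
        have hk : 1 ≤ k := Nat.one_le_iff_ne_zero.2 (by exact_mod_cast h1)
        obtain ⟨j, rfl⟩ := Nat.exists_eq_add_of_le hk
        change (0 : WithTop ℤ) ≤ (((1 + j : ℕ) : ℤ) - (1 : ℤ) : WithTop ℤ)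
        norm_cast
        omega
    · push Not at hx
      have h0 : meromorphicOrderAt (latticeProd τ) x = 0 := by
        rw [(hP.analyticAt x).meromorphicOrderAt_eq,
          (hP.analyticAt x).analyticOrderAt_eq_zero.2 (latticeProd_ne_zero hτ hx)]
        rfl
      rw [h0, sub_zero]
      exact (hϑ.analyticAt x).meromorphicOrderAt_nonneg
  have hmer : Meromorphic (ϑ / latticeProd τ) := fun x =>
    (hϑ.analyticAt x).meromorphicAt.div (hP.analyticAt x).meromorphicAt
  obtain ⟨G, hG, hFG, -⟩ := exists_entire_of_meromorphicOrderAt_nonneg hmer hord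
  have hG1 : ∀ x, G (x + 1) = G x := fun x => by
    simpa using quasiPeriodic_of_eventuallyEq (u := 1) hG.continuous continuous_one hFG
      (fun x => by simp [ϑ, expTwoPiI_add, expTwoPiI_one, latticeProd_add_one]) x
  have hGτ : ∀ x, G (x + τ) = G x := fun x => by
    simpa using quasiPeriodic_of_eventuallyEq (u := 1) hG.continuous continuous_one hFG
      (fun x => by
        have := expTwoPiI_ne_zero x
        rw [Pi.div_apply, Pi.div_apply, hϑτ, latticeProd_add_period hτ,
          mul_div_mul_left _ _ (neg_ne_zero.2 (inv_ne_zero this)), Pi.one_apply, one_mul]) x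
  have hc : ∀ x, ϑ x = G 0 * latticeProd τ x := by
    intro x
    refine eq_of_eventuallyEq_nhdsNE (g := fun x => G 0 * latticeProd τ x)
      hϑ.continuous.continuousAt (hP.continuous.const_mul _).continuousAt ?_
    have hne : ∀ᶠ y in 𝓝[≠] x, latticeProd τ y ≠ 0 := by
      refine (meromorphicOrderAt_ne_top_iff_eventually_ne_zero
        (hP.analyticAt x).meromorphicAt).1 ?_
      refine meromorphicOrderAt_ne_top_of_exists (fun y => (hP.analyticAt y).meromorphicAt)
        (x := 0) ?_ x
      rw [meromorphicOrderAt_latticeProd_zero hτ]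
      exact WithTop.one_ne_top
    filter_upwards [hFG x, hne] with y h1 h2
    rw [apply_eq_apply_of_doublyPeriodic hτ hG hG1 hGτ 0 y, ← h1, Pi.div_apply,
      div_mul_cancel₀ _ h2]
  refine ⟨G 0, fun h0 => ?_, hc⟩
  obtain ⟨x, hx⟩ := exists_theta_comp_ne_zero hτ hq
  exact hx (by rw [show (theta q ∘ expTwoPiI) x = _ from hc x, h0, zero_mul])

theorem meromorphicOrderAt_theta_eq (hτ : 0 < τ.im) (hq : (q : ℂ) = expTwoPiI (-τ)) (x : ℂ) :
    meromorphicOrderAt (theta q ∘ expTwoPiI) x = meromorphicOrderAt (latticeProd τ) x := by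
  obtain ⟨c, hc, h⟩ := exists_theta_eq_latticeProd hτ hq
  rw [show theta q ∘ expTwoPiI = (fun _ => c) * latticeProd τ from funext h,
    meromorphicOrderAt_mul_of_ne_zero analyticAt_const hc]

theorem meromorphicOrderAt_theta_lattice (hτ : 0 < τ.im) (hq : (q : ℂ) = expTwoPiI (-τ))
    (m n : ℤ) : meromorphicOrderAt (theta q ∘ expTwoPiI) (m + n * τ) = 1 := by
  rw [meromorphicOrderAt_theta_eq hτ hq, meromorphicOrderAt_latticeProd_lattice hτ]

theorem meromorphicOrderAt_theta_of_notMem (hτ : 0 < τ.im) (hq : (q : ℂ) = expTwoPiI (-τ)) {x : ℂ}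
    (hx : ∀ m n : ℤ, x ≠ m + n * τ) : meromorphicOrderAt (theta q ∘ expTwoPiI) x = 0 := by
  have hP := (differentiable_latticeProd hτ).analyticAt x
  rw [meromorphicOrderAt_theta_eq hτ hq, hP.meromorphicOrderAt_eq,
    hP.analyticOrderAt_eq_zero.2 (latticeProd_ne_zero hτ hx)]
  rfl

/-! ### Products of powers of translated theta functions, and elliptic functions. -/

theorem prod_zpow_eq_zpow_sum {z : ℂ} (hz : z ≠ 0) {ι : Type*} (S : Finset ι) (n : ι → ℤ) :
    ∏ p ∈ S, z ^ n p = z ^ ∑ p ∈ S, n p := by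
  classical
  induction S using Finset.induction with
  | empty => simp
  | insert a S ha ih => rw [Finset.prod_insert ha, Finset.sum_insert ha, zpow_add₀ hz, ih]

/-- The product of powers of translates of `ϑ = Θ_q ∘ exp (2 π i ·)`. -/
noncomputable def thetaProd (q : ℂˣ) (S : Finset ℂ) (n : ℂ → ℤ) (x : ℂ) : ℂ :=
  ∏ p ∈ S, (theta q ∘ expTwoPiI) (x - p) ^ n p

theorem meromorphicAt_theta_sub (hτ : 0 < τ.im) (hq : (q : ℂ) = expTwoPiI (-τ)) (p x : ℂ) :
    MeromorphicAt (fun x => (theta q ∘ expTwoPiI) (x - p)) x :=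
  (((differentiable_theta_comp hτ hq).comp (f := fun x : ℂ => x - p)
    (by fun_prop)).analyticAt x).meromorphicAt

theorem meromorphic_thetaProd (hτ : 0 < τ.im) (hq : (q : ℂ) = expTwoPiI (-τ)) (S : Finset ℂ)
    (n : ℂ → ℤ) : Meromorphic (thetaProd q S n) := fun x =>
  MeromorphicAt.fun_prod fun p _ => (meromorphicAt_theta_sub hτ hq p x).zpow (n p)

theorem thetaProd_add_one (S : Finset ℂ) (n : ℂ → ℤ) (x : ℂ) :
    thetaProd q S n (x + 1) = thetaProd q S n x :=
  Finset.prod_congr rfl fun p _ => by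
    rw [show x + 1 - p = x - p + 1 by ring, theta_comp_add_one]

theorem thetaProd_add_period (hq : (q : ℂ) = expTwoPiI (-τ)) (S : Finset ℂ) (n : ℂ → ℤ) (x : ℂ) :
    thetaProd q S n (x + τ) =
      (∏ p ∈ S, (-expTwoPiI p) ^ n p) * expTwoPiI x ^ (-∑ p ∈ S, n p) * thetaProd q S n x := by
  have h0 := expTwoPiI_ne_zero x
  rw [thetaProd, thetaProd, ← Finset.sum_neg_distrib, ← prod_zpow_eq_zpow_sum h0,
    ← Finset.prod_mul_distrib, ← Finset.prod_mul_distrib]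
  refine Finset.prod_congr rfl fun p _ => ?_
  rw [show x + τ - p = x - p + τ by ring, theta_comp_add_period hq, expTwoPiI_sub,
    show -(expTwoPiI x / expTwoPiI p)⁻¹ = -expTwoPiI p * (expTwoPiI x)⁻¹ by rw [inv_div]; ring,
    mul_zpow, mul_zpow, inv_zpow, zpow_neg]

/-- Points of the half-open cell are pairwise incongruent modulo the lattice, so at most one factor
contributes to the order. -/
theorem meromorphicOrderAt_thetaProd (hτ : 0 < τ.im) (hq : (q : ℂ) = expTwoPiI (-τ)) (S : Finset ℂ)
    (n : ℂ → ℤ) (hS : ∀ p ∈ S, ∃ s ∈ Set.Ico (0 : ℝ) 1, ∃ t ∈ Set.Ico (0 : ℝ) 1,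
      p = (s : ℂ) + t * τ) {s t : ℝ} (hs : s ∈ Set.Ico (0 : ℝ) 1) (ht : t ∈ Set.Ico (0 : ℝ) 1)
    (hn : (s : ℂ) + t * τ ∉ S → n (s + t * τ) = 0) (a b : ℤ) :
    meromorphicOrderAt (thetaProd q S n) (s + t * τ + (a + b * τ)) = n (s + t * τ) := by
  set y : ℂ := s + t * τ with hy
  have hterm : ∀ p ∈ S, meromorphicOrderAt (fun x => (theta q ∘ expTwoPiI) (x - p) ^ n p)
      (y + (a + b * τ)) = ((if p = y then n p else 0 : ℤ) : WithTop ℤ) := by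
    intro p hp
    change meromorphicOrderAt ((fun x => (theta q ∘ expTwoPiI) (x - p)) ^ n p) _ = _
    rw [meromorphicOrderAt_zpow (meromorphicAt_theta_sub hτ hq p _),
      meromorphicOrderAt_fun_comp_sub_const_eq_meromorphicOrderAt]
    split_ifs with h
    · rw [h, add_sub_cancel_left, meromorphicOrderAt_theta_lattice hτ hq, mul_one]
    · rw [meromorphicOrderAt_theta_of_notMem hτ hq, mul_zero]; · rfl
      intro m k hmk
      apply h
      obtain ⟨s', hs', t', ht', rfl⟩ := hS p hp
      -- Two points of the cell that differ by a lattice vector have coordinates with equal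
      -- fractional parts, hence coincide.
      have e : ((s' + (m - a : ℤ) : ℝ) : ℂ) + ((t' + (k - b : ℤ) : ℝ) : ℂ) * τ = s + t * τ := by
        push_cast
        rw [hy] at hmk
        linear_combination -hmk
      obtain ⟨e1, e2⟩ := (lattice_eq_iff hτ).1 e
      have f1 := Int.fract_add_intCast s' (m - a)
      have f2 := Int.fract_add_intCast t' (k - b)
      rw [e1, Int.fract_eq_self.2 hs, Int.fract_eq_self.2 hs'] at f1
      rw [e2, Int.fract_eq_self.2 ht, Int.fract_eq_self.2 ht'] at f2
      rw [hy, f1, f2]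
  have : thetaProd q S n = fun x => ∏ p ∈ S, (theta q ∘ expTwoPiI) (x - p) ^ n p := rfl
  rw [this, meromorphicOrderAt_fun_prod (f := fun p x => (theta q ∘ expTwoPiI) (x - p) ^ n p)
    fun p _ => (meromorphicAt_theta_sub hτ hq p _).zpow (n p)]
  have hsum : ∑ p ∈ S, ((if p = y then n p else 0 : ℤ) : WithTop ℤ) =
      ((∑ p ∈ S, if p = y then n p else 0 : ℤ) : WithTop ℤ) := by
    rw [WithTop.coe_sum]
  rw [Finset.sum_congr rfl hterm, hsum, Finset.sum_ite_eq']
  split_ifs with h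
  · rfl
  · rw [hn h]

/-- An elliptic function is, up to an exponential factor, a product of theta functions. -/
theorem exists_eventuallyEq_thetaProd (hτ : 0 < τ.im) (hq : (q : ℂ) = expTwoPiI (-τ)) {F : ℂ → ℂ}
    (hF : Meromorphic F) (h1 : ∀ x, F (x + 1) = F x) (h2 : ∀ x, F (x + τ) = F x)
    (htop : ∀ x, meromorphicOrderAt F x ≠ ⊤) :
    ∃ (S : Finset ℂ) (n : ℂ → ℤ) (l : ℂ) (m : ℤ), l ≠ 0 ∧ ∑ p ∈ S, n p = 0 ∧
      ∀ x, F =ᶠ[𝓝[≠] x] fun x => l * expTwoPiI x ^ m * thetaProd q S n x := by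
  classical
  set n : ℂ → ℤ := fun p => (meromorphicOrderAt F p).untop₀ with hn
  set D := MeromorphicOn.divisor F (parallelogram τ)
  have hfin : D.support.Finite := D.finiteSupport (isCompact_parallelogram τ)
  have hDn : ∀ p ∈ parallelogram τ, D p = n p := fun p hp =>
    MeromorphicOn.divisor_apply hF.meromorphicOn hp
  -- Compactness of the closed parallelogram gives finiteness; restricting to the half-open cell
  -- keeps one representative of each class.
  set S : Finset ℂ := hfin.toFinset.filter fun p => ∃ s ∈ Set.Ico (0 : ℝ) 1,
    ∃ t ∈ Set.Ico (0 : ℝ) 1, p = (s : ℂ) + t * τ with hSdef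
  set G := thetaProd q S n with hG
  have hGm : Meromorphic G := meromorphic_thetaProd hτ hq S n
  have hord : ∀ x, meromorphicOrderAt G x = meromorphicOrderAt F x := by
    intro x
    obtain ⟨s, hs, t, ht, a, b, rfl⟩ := exists_eq_add_lattice hτ x
    rw [meromorphicOrderAt_thetaProd hτ hq S n (fun p hp => (Finset.mem_filter.1 hp).2) hs ht _ a b,
      meromorphicOrderAt_add_lattice (u := 1) (fun _ => analyticAt_const) (by simp) h1
        (by simpa using h2), hn]
    · exact WithTop.coe_untop₀_of_ne_top (htop _)
    · intro hnot
      by_contra hne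
      refine hnot (Finset.mem_filter.2 ⟨hfin.mem_toFinset.2 ?_, s, hs, t, ht, rfl⟩)
      rw [Function.mem_support, hDn _ ⟨(s, t), ⟨⟨hs.1, hs.2.le⟩, ht.1, ht.2.le⟩, rfl⟩]
      exact hne
  have hquot : ∀ x, meromorphicOrderAt (F / G) x = 0 := fun x => by
    rw [meromorphicOrderAt_div (hF x) (hGm x), hord]
    exact LinearOrderedAddCommGroupWithTop.sub_self_eq_zero_of_ne_top (htop x)
  obtain ⟨H, hH, hFH, hH0⟩ := exists_entire_of_meromorphicOrderAt_nonneg (hF.div hGm)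
    fun x => (hquot x).ge
  set k := ∑ p ∈ S, n p
  set c := ∏ p ∈ S, (-expTwoPiI p) ^ n p
  have hc : c ≠ 0 :=
    Finset.prod_ne_zero_iff.2 fun p _ => zpow_ne_zero _ (neg_ne_zero.2 (expTwoPiI_ne_zero p))
  have hH1 : ∀ x, H (x + 1) = H x := fun x => by
    simpa using quasiPeriodic_of_eventuallyEq (u := 1) hH.continuous continuous_one hFH
      (fun x => by simp [hG, h1, thetaProd_add_one]) x
  have hHτ : ∀ x, H (x + τ) = c⁻¹ * expTwoPiI x ^ k * H x :=
    quasiPeriodic_of_eventuallyEq hH.continuous (continuous_const.mul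
      (differentiable_expTwoPiI.continuous.zpow₀ k fun x => Or.inl (expTwoPiI_ne_zero x))) hFH
      fun x => by
        have := zpow_ne_zero k (expTwoPiI_ne_zero x)
        rw [Pi.div_apply, Pi.div_apply, h2, hG, thetaProd_add_period hq]
        change F x / (c * expTwoPiI x ^ (-k) * _) = _
        rw [zpow_neg]
        field_simp
  -- That `F` has as many zeros as poles is obtained here as `k = 0`, without integrating along the
  -- boundary of the cell.
  obtain ⟨hk, l, m, hl, hHx⟩ := exists_eq_zpow_of_quasiPeriodic hτ hH (fun x => hH0 x (hquot x))
    hH1 c⁻¹ k (inv_ne_zero hc) hHτ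
  refine ⟨S, n, l, m, hl, hk, fun x => ?_⟩
  have hne := (meromorphicOrderAt_ne_top_iff_eventually_ne_zero (hGm x)).1
    (by rw [hord]; exact htop x)
  filter_upwards [hFH x, hne] with y hy hy0
  rw [← hHx, ← hy, Pi.div_apply, div_mul_cancel₀ _ hy0]

/-! ### Invariant germs -/

theorem mem_invariants_iff {g : MerGerm} {f : ℂ → ℂ} (hg : (g : Germ nearZero ℂ) = ↑f) :
    g ∈ invariants q ↔ (fun z => f (q * z)) =ᶠ[nearZero] f := by
  have h : ((sigma q g : MerGerm) : Germ nearZero ℂ) = ↑(fun z : ℂ => f (q * z)) := by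
    change (g : Germ nearZero ℂ).compTendsto _ (tendsto_mul_nearZero q) = _
    rw [hg]; rfl
  rw [← Germ.coe_eq, ← h, ← hg]
  exact Subtype.ext_iff

theorem elliptic_le_invariants (hq : (q : ℂ) = expTwoPiI (-τ)) : elliptic τ ≤ invariants q := by
  rintro g ⟨F, f, -, -, h2, hf, hg⟩
  refine (mem_invariants_iff hg).2 (eventually_nearZero_ne_zero.mono fun z hz => ?_)
  obtain ⟨x, rfl⟩ := exists_expTwoPiI_eq hz
  have e : q * expTwoPiI x = expTwoPiI (x - τ) := by
    rw [hq, ← expTwoPiI_add]; congr 1; ring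
  change f (q * expTwoPiI x) = f (expTwoPiI x)
  rw [e]
  refine (hf _).trans (Eq.trans ?_ (hf x).symm)
  rw [← h2, sub_add_cancel]

theorem elliptic_le_merCStar : elliptic τ ≤ merCStar := by
  rintro g ⟨F, f, hF, -, -, hf, hg⟩
  refine ⟨f, meromorphicOn_compl_zero_iff.2 ?_, hg⟩
  rwa [show f ∘ expTwoPiI = F from funext hf, ← meromorphicOn_univ]

/-- Every `σ_q`-invariant germ is elliptic, because `σ_q` propagates it from a punctured
neighbourhood of `0` to `ℂ*`. -/
theorem invariants_le_elliptic (hτ : 0 < τ.im) (hq : (q : ℂ) = expTwoPiI (-τ)) :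
    invariants q ≤ elliptic τ := by
  intro g hg
  obtain ⟨f, hf, hgf⟩ := g.2
  have hinv := eventually_bind.1 ((mem_invariants_iff hgf).1 hg)
  have hboth := hf.and hinv
  rw [eventually_nhdsWithin_iff, Metric.eventually_nhds_iff] at hboth
  obtain ⟨r, hr, hfr⟩ := hboth
  set U : Set ℂ := {z | z ≠ 0 ∧ ‖z‖ < r} with hU
  have hUopen : IsOpen U := isOpen_ne.inter (isOpen_lt continuous_norm continuous_const)
  have hfU : MeromorphicOn f U := fun z hz => (hfr (by simpa using hz.2) hz.1).1
  have hfinv : ∀ z ∈ U, (fun z => f (q * z)) =ᶠ[𝓝[≠] z] f := fun z hz =>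
    (hfr (by simpa using hz.2) hz.1).2
  -- For the normal form, invariance off a discrete set becomes equality at every point of `U`, so
  -- it can be iterated pointwise.
  set φ := toMeromorphicNFOn f U with hφ
  have hφNF := meromorphicNFOn_toMeromorphicNFOn f U
  have hφf : ∀ z ∈ U, φ =ᶠ[𝓝[≠] z] f := fun z hz => hfU.toMeromorphicNFOn_eq_self_on_nhdsNE hz
  set p : ℂ := (q : ℂ)⁻¹ with hp
  have hp0 : p ≠ 0 := inv_ne_zero q.ne_zero
  have hpe : p = expTwoPiI τ := by rw [hp, hq, expTwoPiI_neg, inv_inv]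
  have hp1 : ‖p‖ < 1 := by rw [hpe]; exact norm_expTwoPiI_lt_one hτ
  have hpU : ∀ z ∈ U, p * z ∈ U := fun z hz => ⟨mul_ne_zero hp0 hz.1, by
    rw [norm_mul]
    exact (mul_le_of_le_one_left (norm_nonneg z) hp1.le).trans_lt hz.2⟩
  have hmul : ∀ z : ℂ, Tendsto (fun w => p * w) (𝓝[≠] z) (𝓝[≠] (p * z)) := fun z =>
    tendsto_nhdsWithin_of_tendsto_nhds_of_eventually_within _
      ((continuous_const_mul p).continuousAt.tendsto.mono_left nhdsWithin_le_nhds)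
      (eventually_nhdsWithin_of_forall fun w hw h => hw (mul_left_cancel₀ hp0 h))
  have hφinv : ∀ z ∈ U, φ (p * z) = φ z := by
    intro z hz
    have hev : (φ ∘ fun w => p * w) =ᶠ[𝓝[≠] z] φ := by
      filter_upwards [hφf z hz, (hmul z).eventually (hφf _ (hpU z hz)),
        (hmul z).eventually (hfinv _ (hpU z hz))] with w h1 h2 h3
      rw [Function.comp_apply, h2, ← h3, h1, hp, mul_inv_cancel_left₀ q.ne_zero]
    have hNF : MeromorphicNFAt (φ ∘ fun w => p * w) z :=
      (meromorphicNFAt_comp_iff_of_deriv_ne_zero (by fun_prop) (by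
        rw [deriv_const_mul_id']; exact hp0)).2 (hφNF (hpU z hz))
    exact ((hNF.eventuallyEq_nhdsNE_iff_eventuallyEq_nhds (hφNF hz)).1 hev).eq_of_nhds
  have hφpow : ∀ (n : ℕ), ∀ z ∈ U, φ (p ^ n * z) = φ z := by
    intro n
    induction n with
    | zero => simp
    | succ n ih =>
      intro z hz
      rw [pow_succ, mul_assoc, ih _ (hpU z hz), hφinv z hz]
  have hex : ∀ z : ℂ, ∃ n : ℕ, ‖p ^ n * z‖ < r := fun z => by
    have h : Tendsto (fun n : ℕ => p ^ n * z) atTop (𝓝 (0 * z)) :=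
      (tendsto_pow_atTop_nhds_zero_of_norm_lt_one hp1).mul_const z
    rw [zero_mul] at h
    have h2 := h.norm
    rw [norm_zero] at h2
    exact (h2.eventually_lt_const hr).exists
  choose N hN using hex
  set f' : ℂ → ℂ := fun z => φ (p ^ N z * z) with hf'
  -- Any exponent that brings `z` into the disc gives the same value: two choices `n` and `N z` are
  -- compared through `p ^ (n + N z) * z`.
  have hkey : ∀ z ≠ 0, ∀ n : ℕ, ‖p ^ n * z‖ < r → f' z = φ (p ^ n * z) := by
    intro z hz n hn
    have hUn : p ^ n * z ∈ U := ⟨mul_ne_zero (pow_ne_zero _ hp0) hz, hn⟩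
    have hUN : p ^ N z * z ∈ U := ⟨mul_ne_zero (pow_ne_zero _ hp0) hz, hN z⟩
    rw [hf']
    change φ (p ^ N z * z) = _
    rw [← hφpow n _ hUN, ← hφpow (N z) _ hUn]
    congr 1; ring
  have hf'mer : MeromorphicOn f' {0}ᶜ := by
    intro z hz
    have hφm : MeromorphicAt φ (p ^ N z * z) :=
      (hφNF (show p ^ N z * z ∈ U from ⟨mul_ne_zero (pow_ne_zero _ hp0) hz, hN z⟩)).meromorphicAt
    have := hφm.comp_analyticAt (g := fun w => p ^ N z * w) (x := z) (by fun_prop)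
    refine this.congr (EventuallyEq.filter_mono ?_ nhdsWithin_le_nhds)
    -- `N` need not be locally constant, but the exponent `N z` still serves for all `w` near `z`.
    have ho : ∀ᶠ w in 𝓝 z, ‖p ^ N z * w‖ < r :=
      (continuous_const_mul (p ^ N z)).norm.continuousAt.eventually_lt continuousAt_const (hN z)
    filter_upwards [ho, continuousAt_id.eventually_ne hz] with w h1 h2
    exact (hkey w h2 _ h1).symm
  have hf'p : ∀ z ≠ 0, f' (p * z) = f' z := by
    intro z hz
    rw [hkey z hz (N (p * z) + 1) (by rw [pow_succ, mul_assoc]; exact hN _), pow_succ, mul_assoc]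
  refine ⟨f' ∘ expTwoPiI, f', (meromorphicOn_compl_zero_iff.1 hf'mer).meromorphicOn, fun x => ?_,
    fun x => ?_, fun x => rfl, ?_⟩
  · rw [Function.comp_apply, expTwoPiI_add, expTwoPiI_one, mul_one]; rfl
  · rw [Function.comp_apply, expTwoPiI_add, ← hpe, mul_comm, hf'p _ (expTwoPiI_ne_zero x)]; rfl
  · rw [hgf]
    refine Germ.coe_eq.2 (eventually_bind.2 ?_)
    rw [eventually_nhdsWithin_iff, Metric.eventually_nhds_iff]
    refine ⟨r, hr, fun z hz hz0 => ?_⟩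
    have hzU : z ∈ U := ⟨hz0, by simpa using hz⟩
    filter_upwards [hφf z hzU, nhdsWithin_le_nhds (hUopen.mem_nhds hzU)] with w h1 h2
    rw [← h1, hkey w h2.1 0 (by simpa using h2.2), pow_zero, one_mul]

/-! ### Quotients of theta functions -/

theorem thetaC_mul (q c : ℂˣ) {z : ℂ} (hz : z ≠ 0) :
    thetaC q c (q * z) = -(q * z) * (c : ℂ)⁻¹ * thetaC q c z := by
  rw [thetaC, mul_left_comm, theta_mul q (mul_ne_zero (inv_ne_zero c.ne_zero) hz), thetaC]
  ring

theorem thetaC_one (q : ℂˣ) : thetaC q 1 = theta q := by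
  ext z; simp [thetaC]

/-- Iteration of `theta_mul` in both directions. It exhibits `z ^ k`, up to a constant, as a
quotient of two theta functions. -/
theorem exists_theta_zpow_mul (q : ℂˣ) (k : ℤ) :
    ∃ C : ℂ, C ≠ 0 ∧ ∀ z ≠ 0, theta q ((q : ℂ) ^ k * z) = C * z ^ k * theta q z := by
  have hq0 := q.ne_zero
  induction k using Int.induction_on with
  | zero => exact ⟨1, one_ne_zero, fun z _ => by simp⟩
  | succ k ih =>
    obtain ⟨C, hC, h⟩ := ih
    refine ⟨C * -(q : ℂ) ^ ((k : ℤ) + 1), mul_ne_zero hC (neg_ne_zero.2 (zpow_ne_zero _ hq0)),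
      fun z hz => ?_⟩
    rw [zpow_add_one₀ hq0, mul_comm _ (q : ℂ), mul_assoc,
      theta_mul q (mul_ne_zero (zpow_ne_zero _ hq0) hz), h z hz, zpow_add_one₀ hz]
    ring
  | pred k ih =>
    obtain ⟨C, hC, h⟩ := ih
    refine ⟨C * -((q : ℂ) ^ (-(k : ℤ)))⁻¹,
      mul_ne_zero hC (neg_ne_zero.2 (inv_ne_zero (zpow_ne_zero _ hq0))), fun z hz => ?_⟩
    have h' := theta_mul q (mul_ne_zero (zpow_ne_zero (-(k : ℤ) - 1) hq0) hz)
    have e : (q : ℂ) * ((q : ℂ) ^ (-(k : ℤ) - 1) * z) = (q : ℂ) ^ (-(k : ℤ)) * z := by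
      rw [zpow_sub_one₀ hq0]; field_simp
    rw [e, h z hz] at h'
    have hk := zpow_ne_zero (-(k : ℤ)) hq0
    rw [zpow_sub_one₀ hz]
    field_simp
    linear_combination h'

theorem thetaC_expTwoPiI (p x : ℂ) :
    thetaC q (Units.mk0 _ (expTwoPiI_ne_zero p)) (expTwoPiI x) =
      (theta q ∘ expTwoPiI) (x - p) := by
  rw [thetaC, Function.comp_apply, expTwoPiI_sub, Units.val_mk0, div_eq_inv_mul]

theorem meromorphicOn_thetaC (hτ : 0 < τ.im) (hq : (q : ℂ) = expTwoPiI (-τ)) (c : ℂˣ) :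
    MeromorphicOn (thetaC q c) {0}ᶜ := by
  rw [meromorphicOn_compl_zero_iff]
  obtain ⟨p, hp⟩ := exists_expTwoPiI_eq c.ne_zero
  obtain rfl : Units.mk0 _ (expTwoPiI_ne_zero p) = c := Units.ext hp
  rw [show thetaC q (Units.mk0 _ (expTwoPiI_ne_zero p)) ∘ expTwoPiI = _ from
    funext (thetaC_expTwoPiI p)]
  exact fun x => meromorphicAt_theta_sub hτ hq p x

theorem thetaC_comp_eventually_ne_zero (hτ : 0 < τ.im) (hq : (q : ℂ) = expTwoPiI (-τ)) (c : ℂˣ)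
    (x : ℂ) : ∀ᶠ y in 𝓝[≠] x, thetaC q c (expTwoPiI y) ≠ 0 := by
  have hm := meromorphicOn_compl_zero_iff.1 (meromorphicOn_thetaC hτ hq c)
  refine (meromorphicOrderAt_ne_top_iff_eventually_ne_zero (hm x)).1 ?_
  obtain ⟨p, hp⟩ := exists_expTwoPiI_eq c.ne_zero
  obtain rfl : Units.mk0 _ (expTwoPiI_ne_zero p) = c := Units.ext hp
  refine meromorphicOrderAt_ne_top_of_exists hm (x := p) ?_ x
  rw [show thetaC q (Units.mk0 _ (expTwoPiI_ne_zero p)) ∘ expTwoPiI = _ from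
    funext (thetaC_expTwoPiI p), meromorphicOrderAt_fun_comp_sub_const_eq_meromorphicOrderAt]
  have h := meromorphicOrderAt_theta_lattice hτ hq 0 0
  rw [Int.cast_zero, zero_mul, add_zero] at h
  rw [sub_self, h]
  exact WithTop.one_ne_top

theorem thetaC_eventually_ne_zero (hτ : 0 < τ.im) (hq : (q : ℂ) = expTwoPiI (-τ)) (c : ℂˣ) :
    ∀ᶠ z in nearZero, thetaC q c z ≠ 0 := by
  -- The indicator function rewrites nonvanishing as an equality of functions.
  have h := eventuallyEq_nearZero_of_comp (f := fun z => if thetaC q c z = 0 then 0 else 1)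
    (g := fun _ => 1) fun x => (thetaC_comp_eventually_ne_zero hτ hq c x).mono
      fun y hy => by simp [hy]
  exact h.mono fun z hz h0 => by simp [h0] at hz

/-- The function `λ ∏ Θ_{q,a_i} / ∏ Θ_{q,b_i}`. -/
noncomputable def thetaQuot (q : ℂˣ) {r : ℕ} (a b : Fin r → ℂˣ) (l : ℂ) (z : ℂ) : ℂ :=
  l * ((∏ i, thetaC q (a i) z) / ∏ i, thetaC q (b i) z)

theorem prod_thetaC_mul {r : ℕ} (a : Fin r → ℂˣ) {z : ℂ} (hz : z ≠ 0) :
    ∏ i, thetaC q (a i) (q * z) =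
      (-(q * z)) ^ r * (((∏ i, a i : ℂˣ) : ℂ))⁻¹ * ∏ i, thetaC q (a i) z := by
  simp only [thetaC_mul q _ hz, Finset.prod_mul_distrib, Finset.prod_const, Finset.card_univ,
    Fintype.card_fin, Finset.prod_inv_distrib, Units.coe_prod]

/-- Equal numbers of factors above and below cancel `(-q z) ^ r`. The constant that remains is `1`
exactly when the products of the parameters agree. -/
theorem thetaQuot_mul {r : ℕ} (a b : Fin r → ℂˣ) (l : ℂ) {z : ℂ} (hz : z ≠ 0) :
    thetaQuot q a b l (q * z) =
      ((∏ i, b i : ℂˣ) : ℂ) / ((∏ i, a i : ℂˣ) : ℂ) * thetaQuot q a b l z := by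
  have h1 : (-(q * z)) ^ r ≠ 0 := pow_ne_zero _ (neg_ne_zero.2 (mul_ne_zero q.ne_zero hz))
  have h2 := (∏ i, b i).ne_zero
  have h3 := (∏ i, a i).ne_zero
  rw [thetaQuot, thetaQuot, prod_thetaC_mul a hz, prod_thetaC_mul b hz]
  field_simp

theorem meromorphicOn_thetaQuot (hτ : 0 < τ.im) (hq : (q : ℂ) = expTwoPiI (-τ)) {r : ℕ}
    (a b : Fin r → ℂˣ) (l : ℂ) : MeromorphicOn (thetaQuot q a b l) {0}ᶜ := fun z hz =>
  (MeromorphicAt.const l z).mul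
    ((MeromorphicAt.fun_prod fun i _ => meromorphicOn_thetaC hτ hq (a i) z hz).div
      (MeromorphicAt.fun_prod fun i _ => meromorphicOn_thetaC hτ hq (b i) z hz))

theorem mem_elliptic_of_eq_thetaQuot (hτ : 0 < τ.im) (hq : (q : ℂ) = expTwoPiI (-τ)) {g : MerGerm}
    {r : ℕ} {a b : Fin r → ℂˣ} {l : ℂ} (hab : ∏ i, a i = ∏ i, b i)
    (hg : (g : Germ nearZero ℂ) = ↑(thetaQuot q a b l)) : g ∈ elliptic τ := by
  refine ⟨thetaQuot q a b l ∘ expTwoPiI, thetaQuot q a b l, (meromorphicOn_compl_zero_iff.1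
    (meromorphicOn_thetaQuot hτ hq a b l)).meromorphicOn, fun x => ?_, fun x => ?_,
    fun x => rfl, hg⟩
  · rw [Function.comp_apply, expTwoPiI_add, expTwoPiI_one, mul_one]; rfl
  · have h := thetaQuot_mul (q := q) a b l (expTwoPiI_ne_zero (x + τ))
    rw [expTwoPiI_add_period hq, hab, div_self (Units.ne_zero _), one_mul] at h
    exact h.symm

/-- Positive exponents go to the numerator, negative ones to the denominator, repeated according to
multiplicity. -/
theorem exists_thetaProd_eq_multiset (q : ℂˣ) (S : Finset ℂ) (n : ℂ → ℤ) :
    ∃ A B : Multiset ℂˣ, (A.card : ℤ) - B.card = ∑ p ∈ S, n p ∧ ∀ x, thetaProd q S n x =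
      (A.map fun c => thetaC q c (expTwoPiI x)).prod /
        (B.map fun c => thetaC q c (expTwoPiI x)).prod := by
  classical
  induction S using Finset.induction with
  | empty => exact ⟨0, 0, by simp, fun x => by simp [thetaProd]⟩
  | insert p S hp ih =>
    obtain ⟨A, B, hAB, h⟩ := ih
    set u : ℂˣ := Units.mk0 _ (expTwoPiI_ne_zero p)
    refine ⟨Multiset.replicate (n p).toNat u + A, Multiset.replicate (-n p).toNat u + B, ?_,
      fun x => ?_⟩
    · rw [Finset.sum_insert hp, ← hAB]
      simp only [Multiset.card_add, Multiset.card_replicate]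
      push_cast
      omega
    · have hS : thetaProd q (insert p S) n x =
          (theta q ∘ expTwoPiI) (x - p) ^ n p * thetaProd q S n x := Finset.prod_insert hp
      have hz : ∀ (y : ℂ) (k : ℤ), y ^ k = y ^ k.toNat / y ^ (-k).toNat := by
        intro y k
        rcases le_total 0 k with hk | hk
        · rw [Int.toNat_of_nonpos (neg_nonpos.2 hk), pow_zero, div_one, ← zpow_natCast,
            Int.toNat_of_nonneg hk]
        · rw [Int.toNat_of_nonpos hk, pow_zero, one_div, ← zpow_natCast,
            Int.toNat_of_nonneg (neg_nonneg.2 hk), zpow_neg, inv_inv]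
      rw [hS, h x, hz]
      simp only [Multiset.map_add, Multiset.prod_add, Multiset.map_replicate,
        Multiset.prod_replicate]
      rw [show thetaC q u (expTwoPiI x) = _ from thetaC_expTwoPiI p x, div_mul_div_comm]

theorem exists_multiset_eq_map_fin {α : Type*} {r : ℕ} (A : Multiset α) (hA : A.card = r) :
    ∃ a : Fin r → α, A = Finset.univ.val.map a := by
  subst hA
  induction A using Quotient.inductionOn with
  | h L =>
    refine ⟨fun i => L.get i, ?_⟩
    exact (congrArg (fun M : List α => (M : Multiset α)) (List.ofFn_get L).symm).trans
      (Fin.univ_val_map _).symm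

/-- Every nonzero elliptic function is a quotient of products of theta functions. -/
theorem exists_eq_thetaQuot_of_mem_elliptic (hτ : 0 < τ.im) (hq : (q : ℂ) = expTwoPiI (-τ))
    {g : MerGerm} (hg0 : g ≠ 0) (hg : g ∈ elliptic τ) :
    ∃ (r : ℕ) (a b : Fin r → ℂˣ) (l : ℂˣ), ∏ i, a i = ∏ i, b i ∧
      (g : Germ nearZero ℂ) = ↑(thetaQuot q a b l) := by
  have hinv := elliptic_le_invariants hq hg
  obtain ⟨F, f, hF, h1, h2, hf, hgf⟩ := hg
  have hFm : Meromorphic F := meromorphicOn_univ.1 hF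
  have hfF : f ∘ expTwoPiI = F := funext hf
  have htop : ∀ x, meromorphicOrderAt F x ≠ ⊤ := by
    intro x hx
    refine hg0 (Subtype.ext (hgf.trans (Germ.coe_eq.2 ?_)))
    refine eventuallyEq_nearZero_of_comp (g := 0) fun y => ?_
    rw [hfF]
    refine meromorphicOrderAt_eq_top_iff.1 ?_
    by_contra hy
    exact meromorphicOrderAt_ne_top_of_exists hFm hy x hx
  obtain ⟨S, n, l, m, hl, hn, hFx⟩ := exists_eventuallyEq_thetaProd hτ hq hFm h1 h2 htop
  obtain ⟨A, B, hAB, hprod⟩ := exists_thetaProd_eq_multiset q S n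
  obtain ⟨C, hC, hCz⟩ := exists_theta_zpow_mul q (-m)
  have hcard : A.card = B.card := by omega
  -- The extra pair `Θ_q / Θ_{q,q^m}` equals `C⁻¹ z ^ m` and absorbs the monomial, which explains
  -- the factor `C` in `l'`.
  obtain ⟨a, ha⟩ := exists_multiset_eq_map_fin (1 ::ₘ A) (Multiset.card_cons 1 A)
  obtain ⟨b, hb⟩ := exists_multiset_eq_map_fin (r := A.card + 1) (q ^ m ::ₘ B)
    (by rw [Multiset.card_cons, hcard])
  have hP : ∀ z, ∏ i, thetaC q (a i) z = theta q z * (A.map fun c => thetaC q c z).prod := by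
    intro z
    have h := congrArg (fun M => (M.map fun c => thetaC q c z).prod) ha
    simp only [Multiset.map_cons, Multiset.prod_cons, thetaC_one, Multiset.map_map] at h
    exact h.symm
  have hQ : ∀ z, ∏ i, thetaC q (b i) z =
      thetaC q (q ^ m) z * (B.map fun c => thetaC q c z).prod := by
    intro z
    have h := congrArg (fun M => (M.map fun c => thetaC q c z).prod) hb
    simp only [Multiset.map_cons, Multiset.prod_cons, Multiset.map_map] at h
    exact h.symm
  set l' : ℂˣ := Units.mk0 (l * C) (mul_ne_zero hl hC)
  have hfq : f =ᶠ[nearZero] thetaQuot q a b l' := by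
    refine eventuallyEq_nearZero_of_comp fun x => ?_
    rw [hfF]
    have hne := thetaC_comp_eventually_ne_zero hτ hq 1 x
    rw [thetaC_one] at hne
    filter_upwards [hFx x, hne] with y hy hy0
    have hz0 := expTwoPiI_ne_zero y
    rw [hy, Function.comp_apply, thetaQuot, hP, hQ, hprod, thetaC]
    rw [Units.val_zpow_eq_zpow_val, ← zpow_neg, hCz _ hz0, Units.val_mk0, zpow_neg]
    have := zpow_ne_zero m hz0
    rw [mul_div_mul_comm, ← mul_assoc]
    congr 1
    field_simp
  refine ⟨A.card + 1, a, b, l', ?_, hgf.trans (Germ.coe_eq.2 hfq)⟩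
  have hm : MeromorphicOn f {0}ᶜ := by rwa [meromorphicOn_compl_zero_iff, hfF]
  rcases eventually_zero_or_ne_zero (eventually_nhdsWithin_of_forall hm) with h0 | h0
  · exact absurd (Subtype.ext (hgf.trans (Germ.coe_eq.2 h0))) hg0
  -- At one point where `f` is nonzero, invariance forces the multiplier `∏ b_i / ∏ a_i` to be `1`.
  · obtain ⟨z, e1, e2, e3, hz, e4⟩ := (hfq.and (((tendsto_mul_nearZero q).eventually hfq).and
      (((mem_invariants_iff hgf).1 hinv).and (eventually_nearZero_ne_zero.and h0)))).exists
    have h := thetaQuot_mul (q := q) a b l' hz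
    rw [← e1, ← e2, show f (q * z) = f z from e3] at h
    have h5 := mul_right_cancel₀ e4 (h.symm.trans (one_mul _).symm)
    rw [div_eq_one_iff_eq (Units.ne_zero _)] at h5
    exact (Units.ext h5).symm

/-! ### Elliptic functions in the fields generated by theta functions -/

theorem coe_prod_eq {ι : Type*} (s : Finset ι) {G : ι → MerGerm} {f : ι → ℂ → ℂ}
    (h : ∀ i, (G i : Germ nearZero ℂ) = ↑(f i)) :
    ((∏ i ∈ s, G i : MerGerm) : Germ nearZero ℂ) = ↑(fun z => ∏ i ∈ s, f i z) := by
  classical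
  induction s using Finset.induction with
  | empty => rfl
  | insert a s ha ih =>
    simp only [Finset.prod_insert ha]
    rw [Subring.coe_mul, ih, h]; rfl

theorem coe_div_eq {G G' : MerGerm} {f f' : ℂ → ℂ} (h : (G : Germ nearZero ℂ) = ↑f)
    (h' : (G' : Germ nearZero ℂ) = ↑f') :
    ((G / G' : MerGerm) : Germ nearZero ℂ) = ↑(fun z => f z / f' z) := by
  have e : ((G / G' : MerGerm) : Germ nearZero ℂ) =
      (G : Germ nearZero ℂ) * (G' : Germ nearZero ℂ)⁻¹ := by
    rw [div_eq_mul_inv]; rfl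
  rw [e, h, h']
  refine Germ.coe_eq.2 (Eventually.of_forall fun z => ?_)
  exact (div_eq_mul_inv _ _).symm

/-- The germ of a constant. -/
noncomputable def constGerm (l : ℂ) : MerGerm :=
  ⟨↑(fun _ : ℂ => l), fun _ => l, Eventually.of_forall fun z => MeromorphicAt.const l z, rfl⟩

theorem constGerm_mem_mer (l : ℂ) (U : Set ℂ) : constGerm l ∈ mer U :=
  ⟨fun _ => l, fun z _ => MeromorphicAt.const l z, rfl⟩

theorem exists_thetaGerm (hτ : 0 < τ.im) (hq : (q : ℂ) = expTwoPiI (-τ)) :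
    ∃ T : ℂˣ → MerGerm, (∀ c, (T c : Germ nearZero ℂ) = ↑(thetaC q c)) ∧ (∀ c, T c ≠ 0) ∧
      ∀ g ∈ elliptic τ, g ≠ 0 → ∃ (r : ℕ) (a b : Fin r → ℂˣ) (l : ℂ),
        g = constGerm l * ((∏ i, T (a i)) / ∏ i, T (b i)) := by
  refine ⟨fun c => ⟨↑(thetaC q c), thetaC q c,
    eventually_nhdsWithin_of_forall (meromorphicOn_thetaC hτ hq c), rfl⟩, fun c => rfl,
    fun c hc => ?_, fun g hg hg0 => ?_⟩
  · have h : thetaC q c =ᶠ[nearZero] 0 := Germ.coe_eq.1 (congrArg Subtype.val hc)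
    obtain ⟨z, hz, hz0⟩ := (h.and (thetaC_eventually_ne_zero hτ hq c)).exists
    exact hz0 hz
  · obtain ⟨r, a, b, l, -, h⟩ := exists_eq_thetaQuot_of_mem_elliptic hτ hq hg0 hg
    refine ⟨r, a, b, l, Subtype.ext ?_⟩
    rw [h, Subring.coe_mul, coe_div_eq (coe_prod_eq _ fun i => rfl) (coe_prod_eq _ fun i => rfl)]
    rfl

theorem mem_adjoinFun_of_mem {k : Subfield MerGerm} {S : Set (ℂ → ℂ)} {g : MerGerm} (hg : g ∈ k) :
    g ∈ adjoinFun k S := Subfield.subset_closure (Or.inl hg)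

theorem mem_adjoinFun_of_eq {k : Subfield MerGerm} {S : Set (ℂ → ℂ)} {g : MerGerm} {f : ℂ → ℂ}
    (hf : f ∈ S) (hg : (g : Germ nearZero ℂ) = ↑f) : g ∈ adjoinFun k S :=
  Subfield.subset_closure (Or.inr ⟨f, hf, hg⟩)

/-- Only constants are taken from the base field, so one argument serves both `k₀` and `k₀'`. -/
theorem elliptic_le_adjoinFun_eChar (hτ : 0 < τ.im) (hq : (q : ℂ) = expTwoPiI (-τ)) (U : Set ℂ) :
    elliptic τ ≤ adjoinFun (mer U) ({qLog q} ∪ Set.range (eChar q)) := by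
  obtain ⟨T, hT, hT0, hell⟩ := exists_thetaGerm hτ hq
  intro g hg
  rcases eq_or_ne g 0 with rfl | hg0
  · exact zero_mem _
  obtain ⟨r, a, b, l, rfl⟩ := hell g hg hg0
  have hE : ∀ c, T 1 / T c ∈ adjoinFun (mer U) ({qLog q} ∪ Set.range (eChar q)) := fun c => by
    refine mem_adjoinFun_of_eq (Or.inr ⟨c, rfl⟩) ?_
    rw [coe_div_eq (hT 1) (hT c), thetaC_one]; rfl
  -- Dividing `T 1 ^ r` by numerator and denominator turns thetas into characters and exchanges the
  -- roles of `a` and `b`.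
  have e : (∏ i, T (a i)) / ∏ i, T (b i) = (∏ i, (T 1 / T (b i))) / ∏ i, (T 1 / T (a i)) := by
    rw [Finset.prod_div_distrib, Finset.prod_div_distrib, Finset.prod_const]
    have h1 := pow_ne_zero (Finset.univ : Finset (Fin r)).card (hT0 1)
    rw [div_div_div_cancel_left' _ _ h1]
  rw [e]
  exact mul_mem (mem_adjoinFun_of_mem (constGerm_mem_mer l U))
    (div_mem (prod_mem fun i _ => hE _) (prod_mem fun i _ => hE _))

theorem elliptic_le_adjoinFun_thetaC (hτ : 0 < τ.im) (hq : (q : ℂ) = expTwoPiI (-τ)) (U : Set ℂ) :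
    elliptic τ ≤ adjoinFun (mer U) ({deriv (theta q)} ∪ Set.range (thetaC q)) := by
  obtain ⟨T, hT, hT0, hell⟩ := exists_thetaGerm hτ hq
  intro g hg
  rcases eq_or_ne g 0 with rfl | hg0
  · exact zero_mem _
  obtain ⟨r, a, b, l, rfl⟩ := hell g hg hg0
  have hE : ∀ c, T c ∈ adjoinFun (mer U) ({deriv (theta q)} ∪ Set.range (thetaC q)) := fun c =>
    mem_adjoinFun_of_eq (Or.inr ⟨c, rfl⟩) (hT c)
  exact mul_mem (mem_adjoinFun_of_mem (constGerm_mem_mer l U))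
    (div_mem (prod_mem fun i _ => hE _) (prod_mem fun i _ => hE _))

theorem inf_invariants_eq_elliptic (hτ : 0 < τ.im) (hq : (q : ℂ) = expTwoPiI (-τ))
    {K : Subfield MerGerm} (hK : elliptic τ ≤ K) : K ⊓ invariants q = elliptic τ :=
  le_antisymm (inf_le_right.trans (invariants_le_elliptic hτ hq))
    (le_inf hK (elliptic_le_invariants hq))

end QDiff

/-! ### The main theorem. -/

theorem mainTheorem11 (τ : ℂ) (hτ : 0 < τ.im) (q : ℂˣ)
    (hq : (q : ℂ) = Complex.exp (-(2 * Real.pi * Complex.I * τ))) :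
    QDiff.K₀ q ⊓ QDiff.invariants q = QDiff.elliptic τ ∧
    QDiff.K₀' q ⊓ QDiff.invariants q = QDiff.elliptic τ ∧
    QDiff.L₀' q ⊓ QDiff.invariants q = QDiff.elliptic τ ∧
    QDiff.merCStar ⊓ QDiff.invariants q = QDiff.elliptic τ ∧
    ∀ g : QDiff.MerGerm, g ≠ 0 →
      (g ∈ QDiff.elliptic τ ↔
        ∃ (r : ℕ) (a b : Fin r → ℂˣ) (l : ℂˣ), ∏ i, a i = ∏ i, b i ∧
          (g : Germ QDiff.nearZero ℂ) =
            ↑(fun z : ℂ => (l : ℂ) * ((∏ i, QDiff.thetaC q (a i) z) /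
              ∏ i, QDiff.thetaC q (b i) z))) := by
  have hq' : (q : ℂ) = QDiff.expTwoPiI (-τ) := by rw [hq, QDiff.expTwoPiI, mul_neg]
  refine ⟨QDiff.inf_invariants_eq_elliptic hτ hq' (QDiff.elliptic_le_adjoinFun_eChar hτ hq' _),
    QDiff.inf_invariants_eq_elliptic hτ hq' (QDiff.elliptic_le_adjoinFun_eChar hτ hq' _),
    QDiff.inf_invariants_eq_elliptic hτ hq' (QDiff.elliptic_le_adjoinFun_thetaC hτ hq' _),
    QDiff.inf_invariants_eq_elliptic hτ hq' QDiff.elliptic_le_merCStar,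
    fun g hg => ⟨QDiff.exists_eq_thetaQuot_of_mem_elliptic hτ hq' hg, ?_⟩⟩
  rintro ⟨r, a, b, l, hab, h⟩
  exact QDiff.mem_elliptic_of_eq_thetaQuot hτ hq' hab h
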